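/- Consider Welander's nondimensionalized box model $\dot T = 1-T-kT$, $\dot S=\beta(1-S)-kS$, with $\rho=-\alpha T+S$, with $\alpha=\tfrac45$, $\beta=\tfrac12$, and with the Heaviside mixing rate $k=1$ for $\rho>\varepsilon$ and $k=0$ for $\rho<\varepsilon$. In the coordinates $x=T$, $y=S-\alpha T-\varepsilon$ it reads $$\dot x = 1-x-kx,\qquad \dot y=\beta-\beta\varepsilon-k\varepsilon-\alpha-(\beta+k)y-(\alpha\beta-\alpha)x,$$ with $k=1$ for $y>0$ and $k=0$ for $y<0$. Solutions are understood in the sense of Filippov: locally absolutely continuous curves that satisfy this system for almost every time with some $k\in[0,1]$, where $k=1$ if $y>0$ and $k=0$ if $y<0$. The sliding region is the set of points of $y=0$ at which $\dot y=0$ for some $k\in[0,1]$; it is called stable (unstable) if $\partial\dot y/\partial k<0$ ($>0$) at all such points and $k$. Then: 1. For every $\varepsilon\in\mathbb R$ the sliding region is the closed segment of the line $y=0$ with endpoints $x=\tfrac34+\tfrac{15}4\varepsilon$ and $x=\tfrac34+\tfrac54\varepsilon$. On $y=0$, the field with $k=1$ is tangent to the line exactly at the first endpoint and the field with $k=0$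 exactly at the second. 2. The sliding region is stable for every $\varepsilon>0$ and unstable for every $\varepsilon<0$. 3. For $\varepsilon=0$ the sliding region is the single point $p=(\tfrac34,0)$, and $p$ is a stable fused focus, that is: (a) $p$ is an invisible double tangency: both fields are tangent to $y=0$ at $p$, and, for all small $t\neq0$, the trajectory of the field with $k=1$ (respectively $k=0$) that passes through $p$ at time $t=0$ lies in $y<0$ (respectively $y>0$); (b) every solution on $[0,\infty)$ that starts close enough to $p$, but not at $p$, takes both positive and negative values of $y$ at arbitrarily large times; (c) $p$ is asymptotically stable (Lyapunov stable and locally attracting) for the solutions on $[0,\infty)$. 4. For $\varepsilon<0$ a small stable periodic orbit exists near $p$: for every $\delta>0$ there is $\varepsilon_0>0$ such that for every $\varepsilon\in(-\varepsilon_0,0)$ there is a nonconstant periodic solution whose orbit $\Gamma$ lies in the ball of radius $\delta$ around $p$ and is asymptotically stable: solutions on $[0,\infty)$ that start close enough to $\Gamma$ stay close to $\Gamma$, and their distance to $\Gamma$ tends to $0$. In this sense, as $\varepsilon$ decreases through $0$, the system undergoes a nonsmooth analogue of a supercritical Hopf bifurcation. -/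

import Mathlib

open Set Filter Topology MeasureTheory

/-! ### Planar (and general) Filippov systems

A nonsmooth system `ẋ = f(x; k)` switches between `f(·; 1)` where `h > 0` and `f(·; 0)`
where `h < 0`. -/

/-- The values the switching parameter may take where the switching function has value `s`. -/
def switchValues (s : ℝ) : Set ℝ :=
  {k | k ∈ Icc (0 : ℝ) 1 ∧ (0 < s → k = 1) ∧ (s < 0 → k = 0)}

/-- The Filippov set of admissible velocities at `p`. When `f p k` is affine in `k`, this is the
segment joining `f p 0` and `f p 1` if `h p = 0`, and a single vector otherwise. -/
def filippovSet {E : Type*} (f : E → ℝ → E) (h : E → ℝ) (p : E) : Set E :=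
  f p '' switchValues (h p)

/-- A Filippov solution on the time set `I`: a locally absolutely continuous curve whose velocity
lies in the Filippov set at almost every time. -/
def IsFilippovSolution {E : Type*} [NormedAddCommGroup E] [NormedSpace ℝ E]
    (f : E → ℝ → E) (h : E → ℝ) (I : Set ℝ) (γ : ℝ → E) : Prop :=
  (∀ a b : ℝ, uIcc a b ⊆ I → AbsolutelyContinuousOnInterval γ a b) ∧
    ∀ᵐ t ∂(volume.restrict I), ∃ v ∈ filippovSet f h (γ t), HasDerivAt γ v t

/-- `S = f(p; k) · ∇h(p)`. -/
noncomputable def switchRate {E : Type*} [NormedAddCommGroup E] [NormedSpace ℝ E]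
    (f : E → ℝ → E) (h : E → ℝ) (p : E) (k : ℝ) : ℝ :=
  fderiv ℝ h p (f p k)

/-- The points of the splitting manifold at which `S = 0` is solvable with `k ∈ [0, 1]`. -/
def slidingRegion {E : Type*} [NormedAddCommGroup E] [NormedSpace ℝ E]
    (f : E → ℝ → E) (h : E → ℝ) : Set E :=
  {p | h p = 0 ∧ ∃ k ∈ Icc (0 : ℝ) 1, switchRate f h p k = 0}

/-- The sliding region is stable: `dS/dk < 0` at every solution of the sliding equations. -/
def IsStableSliding {E : Type*} [NormedAddCommGroup E] [NormedSpace ℝ E]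
    (f : E → ℝ → E) (h : E → ℝ) : Prop :=
  ∀ p ∈ slidingRegion f h, ∀ k ∈ Icc (0 : ℝ) 1, switchRate f h p k = 0 →
    deriv (switchRate f h p) k < 0

/-- The sliding region is unstable: `dS/dk > 0` at every solution of the sliding equations. -/
def IsUnstableSliding {E : Type*} [NormedAddCommGroup E] [NormedSpace ℝ E]
    (f : E → ℝ → E) (h : E → ℝ) : Prop :=
  ∀ p ∈ slidingRegion f h, ∀ k ∈ Icc (0 : ℝ) 1, switchRate f h p k = 0 →
    0 < deriv (switchRate f h p) k

/-- Both fields are tangent to `h = 0` at `p`, and both tangencies are invisible: near `p`, the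
trajectory of either field through `p` stays, except at `p`, strictly on the side where that
field does not apply. -/
structure IsInvisibleDoubleTangency {E : Type*} [NormedAddCommGroup E] [NormedSpace ℝ E]
    (f : E → ℝ → E) (h : E → ℝ) (p : E) : Prop where
  mem_manifold : h p = 0
  tangent_pos : switchRate f h p 1 = 0
  tangent_neg : switchRate f h p 0 = 0
  invisible_pos : ∀ γ : ℝ → E, γ 0 = p → IsIntegralCurveAt γ (fun _ x => f x 1) 0 →
    ∀ᶠ t in 𝓝[≠] (0 : ℝ), h (γ t) < 0
  invisible_neg : ∀ γ : ℝ → E, γ 0 = p → IsIntegralCurveAt γ (fun _ x => f x 0) 0 →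
    ∀ᶠ t in 𝓝[≠] (0 : ℝ), 0 < h (γ t)

/-- Asymptotic stability of a set `K` (a point or a periodic orbit) for the forward Filippov
solutions: Lyapunov stability together with local attraction. -/
def IsAsymptoticallyStable {E : Type*} [NormedAddCommGroup E] [NormedSpace ℝ E]
    (f : E → ℝ → E) (h : E → ℝ) (K : Set E) : Prop :=
  (∀ η > 0, ∃ δ > 0, ∀ γ : ℝ → E, IsFilippovSolution f h (Ici 0) γ →
    Metric.infDist (γ 0) K < δ → ∀ t ≥ 0, Metric.infDist (γ t) K < η) ∧
  ∃ δ > 0, ∀ γ : ℝ → E, IsFilippovSolution f h (Ici 0) γ →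
    Metric.infDist (γ 0) K < δ → Tendsto (fun t => Metric.infDist (γ t) K) atTop (𝓝 0)

/-- A stable fused focus: an invisible double tangency that is asymptotically stable and around
which all nearby nontrivial solutions keep alternating between the two sides forever. -/
structure IsStableFusedFocus {E : Type*} [NormedAddCommGroup E] [NormedSpace ℝ E]
    (f : E → ℝ → E) (h : E → ℝ) (p : E) : Prop where
  doubleTangency : IsInvisibleDoubleTangency f h p
  focus : ∃ δ > 0, ∀ γ : ℝ → E, IsFilippovSolution f h (Ici 0) γ →
    γ 0 ≠ p → dist (γ 0) p < δ →
      (∃ᶠ t in atTop, 0 < h (γ t)) ∧ (∃ᶠ t in atTop, h (γ t) < 0)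
  stable : IsAsymptoticallyStable f h {p}

/-- A periodic orbit of the Filippov system: the range of a nonconstant periodic Filippov
solution. -/
def IsPeriodicOrbit {E : Type*} [NormedAddCommGroup E] [NormedSpace ℝ E]
    (f : E → ℝ → E) (h : E → ℝ) (Γ : Set E) : Prop :=
  ∃ γ : ℝ → E, IsFilippovSolution f h univ γ ∧ (∃ τ > 0, Function.Periodic γ τ) ∧
    (∃ s t, γ s ≠ γ t) ∧ range γ = Γ

/-! ### Welander's model -/

/-- Welander's nondimensionalized box model for `(T, S)` with convective mixing rate `k`. -/
def welanderTS (β : ℝ) (q : ℝ × ℝ) (k : ℝ) : ℝ × ℝ :=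
  (1 - q.1 - k * q.1, β * (1 - q.2) - k * q.2)

/-- The same field in the coordinates `x = T`, `y = S - α T - ε`, in which the splitting manifold
`-α T + S = ε` is `y = 0`; so `k = 1` for `y > 0` and `k = 0` for `y < 0`. -/
def welander (α β ε : ℝ) (p : ℝ × ℝ) (k : ℝ) : ℝ × ℝ :=
  ((welanderTS β (p.1, p.2 + α * p.1 + ε) k).1,
    (welanderTS β (p.1, p.2 + α * p.1 + ε) k).2
      - α * (welanderTS β (p.1, p.2 + α * p.1 + ε) k).1)

theorem welander_eq (α β ε x y k : ℝ) :
    welander α β ε (x, y) k =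
      (1 - x - k * x,
        β - β * ε - k * ε - α - (β + k) * y - (α * β - α) * x) := by
  simp only [welander, welanderTS, Prod.mk.injEq, true_and]
  ring

/-! In the original variables both fields are linear and decoupled: for k = 1 the quantities T - 1/2
and S - 1/3 decay at rates 2 and 3/2, for k = 0 the quantities 1 - T and 1 - S decay at rates 1 and
1/2. With θ = exp(-t/2) these become multiples of θ⁴, θ³ and of θ², θ, so questions about the flow
reduce to polynomial identities and inequalities.

The sliding region and its stability follow from ẏ being affine in k. For the fused focus put u = x
- 3/4 and V = u² + max(5y/2, -5y/4). Along every solution -4V ≤ V' ≤ -V/2 almost everywhere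
(`IsFilippovSolution.ae_deriv_focusLyapunov`). The upper bound gives asymptotic stability; the lower
bound shows that the focus is not reached in finite time. A solution that eventually stayed on one
side would then have x drifting at a rate bounded away from zero, against its convergence.

For ε < 0 the periodic orbit consists of one arc on each side (`IsTwoArcCycle`). Any such cycle is
asymptotically stable, and no return map is needed. A first integral of each field yields functions
W₁ (for y ≥ 0) and W₀ (for y ≤ 0) that vanish exactly on the cycle and decay exponentially. At the
two crossings the slopes of W₁ and W₀ along y = 0 are compared: a relative weight κ makes both
passages nonincreasing (`IsTwoArcCycle.exists_weight`), thanks to 8ξ(1 + q)(1 - q)² > 0.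
`isAsymptoticallyStable_of_splitFun` turns this into stability for all Filippov solutions.

For existence, the contraction factor q of the upper arc determines the remaining data explicitly.
The parameter ε(q) is continuous near q = 1, zero at q = 1 and negative just below
(`CycleFamily.ε_neg`), so the intermediate value theorem reaches every small negative ε. -/

/-! ### Absolutely continuous functions and exponential bounds. -/

theorem LipschitzWith.comp_absolutelyContinuousOnInterval {X Y : Type*} [PseudoMetricSpace X]
    [PseudoMetricSpace Y] {K : NNReal} {g : X → Y} {f : ℝ → X} {a b : ℝ} (hg : LipschitzWith K g)
    (hf : AbsolutelyContinuousOnInterval f a b) :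
    AbsolutelyContinuousOnInterval (fun t => g (f t)) a b := by
  unfold AbsolutelyContinuousOnInterval at hf ⊢
  refine squeeze_zero (fun t => Finset.sum_nonneg fun i _ => dist_nonneg) (fun t => ?_)
    (by simpa using hf.const_mul (K : ℝ))
  rw [Finset.mul_sum]
  exact Finset.sum_le_sum fun i _ => hg.dist_le_mul _ _

theorem AbsolutelyContinuousOnInterval.le_of_ae_deriv_nonpos {f : ℝ → ℝ} {a b : ℝ} (hab : a ≤ b)
    (hf : AbsolutelyContinuousOnInterval f a b)
    (h : ∀ᵐ t, t ∈ Ioo a b → deriv f t ≤ 0) : f b ≤ f a := by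
  have h1 := hf.integral_deriv_eq_sub
  have h2 : ∫ t in a..b, deriv f t ≤ 0 := by
    rw [intervalIntegral.integral_of_le hab]
    refine integral_nonpos_of_ae ?_
    rw [EventuallyLE, ae_restrict_iff' measurableSet_Ioc]
    have hb : ∀ᵐ t : ℝ, t ≠ b := by simp [ae_iff, measure_singleton]
    filter_upwards [h, hb] with t ht htb htm
    exact ht ⟨htm.1, lt_of_le_of_ne htm.2 htb⟩
  linarith

theorem AbsolutelyContinuousOnInterval.mul_exp {f : ℝ → ℝ} {a b : ℝ} (c : ℝ)
    (hf : AbsolutelyContinuousOnInterval f a b) :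
    AbsolutelyContinuousOnInterval (fun t => f t * Real.exp (c * t)) a b := by
  refine hf.fun_mul (ContDiffOn.absolutelyContinuousOnInterval ?_)
  exact ContDiff.contDiffOn (by fun_prop)

/-- A scalar Grönwall inequality for absolutely continuous functions. -/
theorem AbsolutelyContinuousOnInterval.le_exp_of_ae_deriv_le {f : ℝ → ℝ} {a b c : ℝ} (hab : a ≤ b)
    (hf : AbsolutelyContinuousOnInterval f a b)
    (h : ∀ᵐ t, t ∈ Ioo a b → ∃ v, HasDerivAt f v t ∧ v ≤ -c * f t) :
    f b ≤ f a * Real.exp (-c * (b - a)) := by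
  have h1 := (hf.mul_exp c).le_of_ae_deriv_nonpos hab (by
    filter_upwards [h] with t ht htm
    obtain ⟨v, hv, hv'⟩ := ht htm
    have h2 : HasDerivAt (fun t => Real.exp (c * t)) (Real.exp (c * t) * c) t := by
      simpa using ((hasDerivAt_id t).const_mul c).exp
    rw [(hv.fun_mul h2).deriv]
    nlinarith [Real.exp_pos (c * t)])
  have h2 : f a * Real.exp (-c * (b - a)) = f a * Real.exp (c * a) * Real.exp (-(c * b)) := by
    rw [mul_assoc, ← Real.exp_add]; ring_nf
  have h3 : f b = f b * Real.exp (c * b) * Real.exp (-(c * b)) := by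
    rw [mul_assoc, ← Real.exp_add]; simp
  rw [h2, h3]
  exact mul_le_mul_of_nonneg_right h1 (Real.exp_pos _).le

theorem AbsolutelyContinuousOnInterval.exp_le_of_ae_le_deriv {f : ℝ → ℝ} {a b c : ℝ} (hab : a ≤ b)
    (hf : AbsolutelyContinuousOnInterval f a b)
    (h : ∀ᵐ t, t ∈ Ioo a b → ∃ v, HasDerivAt f v t ∧ -c * f t ≤ v) :
    f a * Real.exp (-c * (b - a)) ≤ f b := by
  have h1 := hf.neg.le_exp_of_ae_deriv_le (c := c) hab (by
    filter_upwards [h] with t ht htm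
    obtain ⟨v, hv, hv'⟩ := ht htm
    exact ⟨-v, hv.neg, by simp only [Pi.neg_apply]; linarith⟩)
  simp only [Pi.neg_apply] at h1
  linarith

theorem AbsolutelyContinuousOnInterval.eq_exp_of_ae_deriv_eq {f : ℝ → ℝ} {a b c : ℝ} (hab : a ≤ b)
    (hf : AbsolutelyContinuousOnInterval f a b)
    (h : ∀ᵐ t, t ∈ Ioo a b → HasDerivAt f (-c * f t) t) :
    f b = f a * Real.exp (-c * (b - a)) := by
  apply le_antisymm
  · refine hf.le_exp_of_ae_deriv_le hab ?_
    filter_upwards [h] with t ht htm using ⟨_, ht htm, le_rfl⟩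
  · refine hf.exp_le_of_ae_le_deriv hab ?_
    filter_upwards [h] with t ht htm using ⟨_, ht htm, le_rfl⟩

/-! ### Filippov solutions of the model: explicit flow off the switching line, and crossings. -/

/-- Welander's model with `α = 4/5`, `β = 1/2`. -/
noncomputable abbrev welanderField (ε : ℝ) : ℝ × ℝ → ℝ → ℝ × ℝ := welander (4 / 5) (1 / 2) ε

section Solutions

variable {ε : ℝ} {γ : ℝ → ℝ × ℝ}

theorem IsFilippovSolution.ac_fst (hγ : IsFilippovSolution (welanderField ε) Prod.snd (Ici 0) γ)
    {a b : ℝ} (ha : 0 ≤ a) (hb : 0 ≤ b) :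
    AbsolutelyContinuousOnInterval (fun t => (γ t).1) a b :=
  LipschitzWith.prod_fst.comp_absolutelyContinuousOnInterval
    (hγ.1 a b fun _ ht => le_trans (le_min ha hb) ht.1)

theorem IsFilippovSolution.ac_snd (hγ : IsFilippovSolution (welanderField ε) Prod.snd (Ici 0) γ)
    {a b : ℝ} (ha : 0 ≤ a) (hb : 0 ≤ b) :
    AbsolutelyContinuousOnInterval (fun t => (γ t).2) a b :=
  LipschitzWith.prod_snd.comp_absolutelyContinuousOnInterval
    (hγ.1 a b fun _ ht => le_trans (le_min ha hb) ht.1)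

theorem IsFilippovSolution.continuousOn
    (hγ : IsFilippovSolution (welanderField ε) Prod.snd (Ici 0) γ) : ContinuousOn γ (Ici 0) := by
  intro t ht
  have h1 : ContinuousOn γ (uIcc 0 (t + 1)) :=
    (hγ.1 0 (t + 1) fun s hs => by
      rw [uIcc_of_le (by linarith [mem_Ici.1 ht])] at hs; exact hs.1).continuousOn
  rw [uIcc_of_le (by linarith [mem_Ici.1 ht])] at h1
  refine (h1 t ⟨ht, by linarith⟩).mono_of_mem_nhdsWithin ?_
  rw [← Ici_inter_Iic]
  exact inter_mem self_mem_nhdsWithin (mem_nhdsWithin_of_mem_nhds (Iic_mem_nhds (by linarith)))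

theorem IsFilippovSolution.ae_hasDerivAt
    (hγ : IsFilippovSolution (welanderField ε) Prod.snd (Ici 0) γ) :
    ∀ᵐ t, 0 ≤ t → ∃ k ∈ switchValues (γ t).2,
      HasDerivAt (fun t => (γ t).1) (1 - (γ t).1 - k * (γ t).1) t ∧
      HasDerivAt (fun t => (γ t).2) (-3 / 10 - ε / 2 - k * ε - (1 / 2 + k) * (γ t).2
        + 2 / 5 * (γ t).1) t := by
  have h := hγ.2
  rw [ae_restrict_iff' measurableSet_Ici] at h
  filter_upwards [h] with t ht h0
  obtain ⟨v, ⟨k, hk, rfl⟩, hv⟩ := ht h0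
  refine ⟨k, hk, ?_, ?_⟩
  · have h1 := (ContinuousLinearMap.fst ℝ ℝ ℝ).hasFDerivAt.comp_hasDerivAt t hv
    convert! h1 using 1
  · have h1 := (ContinuousLinearMap.snd ℝ ℝ ℝ).hasFDerivAt.comp_hasDerivAt t hv
    convert! h1 using 1
    simp [welanderField, welander, welanderTS]
    ring

/-- Since y + 4x/5 + ε is S, these are the two decoupled linear equations for k = 1. The sign is
required on the open interval only, so that arcs with endpoints on the switching line are covered.
-/
theorem IsFilippovSolution.flow_of_pos
    (hγ : IsFilippovSolution (welanderField ε) Prod.snd (Ici 0) γ) {a b : ℝ} (ha : 0 ≤ a)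
    (hab : a ≤ b) (h : ∀ t ∈ Ioo a b, 0 < (γ t).2) :
    (γ b).1 - 1 / 2 = ((γ a).1 - 1 / 2) * Real.exp (-2 * (b - a)) ∧
    (γ b).2 + 4 / 5 * (γ b).1 + ε - 1 / 3 =
      ((γ a).2 + 4 / 5 * (γ a).1 + ε - 1 / 3) * Real.exp (-(3 / 2) * (b - a)) := by
  have hb := ha.trans hab
  have hc : ∀ c : ℝ, AbsolutelyContinuousOnInterval (fun _ => c) a b := fun c =>
    ContDiffOn.absolutelyContinuousOnInterval (ContDiff.contDiffOn (by fun_prop))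
  constructor
  · refine AbsolutelyContinuousOnInterval.eq_exp_of_ae_deriv_eq (f := fun t => (γ t).1 - 1 / 2) hab
      ((hγ.ac_fst ha hb).sub (hc _)) ?_
    filter_upwards [hγ.ae_hasDerivAt] with t ht htm
    obtain ⟨k, hk, h1, h2⟩ := ht (ha.trans htm.1.le)
    obtain rfl := hk.2.1 (h t htm)
    convert! h1.sub_const (1 / 2) using 1
    ring
  · refine AbsolutelyContinuousOnInterval.eq_exp_of_ae_deriv_eq
      (f := fun t => (γ t).2 + 4 / 5 * (γ t).1 + ε - 1 / 3) hab
      ((((hγ.ac_snd ha hb).add ((hγ.ac_fst ha hb).const_mul (4 / 5))).add (hc _)).sub (hc _)) ?_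
    filter_upwards [hγ.ae_hasDerivAt] with t ht htm
    obtain ⟨k, hk, h1, h2⟩ := ht (ha.trans htm.1.le)
    obtain rfl := hk.2.1 (h t htm)
    convert! ((h2.add (h1.const_mul (4 / 5))).add_const ε).sub_const (1 / 3) using 1
    ring

theorem IsFilippovSolution.flow_of_neg
    (hγ : IsFilippovSolution (welanderField ε) Prod.snd (Ici 0) γ) {a b : ℝ} (ha : 0 ≤ a)
    (hab : a ≤ b) (h : ∀ t ∈ Ioo a b, (γ t).2 < 0) :
    1 - (γ b).1 = (1 - (γ a).1) * Real.exp (-1 * (b - a)) ∧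
    1 - ((γ b).2 + 4 / 5 * (γ b).1 + ε) =
      (1 - ((γ a).2 + 4 / 5 * (γ a).1 + ε)) * Real.exp (-(1 / 2) * (b - a)) := by
  have hb := ha.trans hab
  have hc : ∀ c : ℝ, AbsolutelyContinuousOnInterval (fun _ => c) a b := fun c =>
    ContDiffOn.absolutelyContinuousOnInterval (ContDiff.contDiffOn (by fun_prop))
  constructor
  · refine AbsolutelyContinuousOnInterval.eq_exp_of_ae_deriv_eq (f := fun t => 1 - (γ t).1) hab
      ((hc _).sub (hγ.ac_fst ha hb)) ?_
    filter_upwards [hγ.ae_hasDerivAt] with t ht htm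
    obtain ⟨k, hk, h1, h2⟩ := ht (ha.trans htm.1.le)
    obtain rfl := hk.2.2 (h t htm)
    convert! h1.const_sub 1 using 1
    ring
  · refine AbsolutelyContinuousOnInterval.eq_exp_of_ae_deriv_eq
      (f := fun t => 1 - ((γ t).2 + 4 / 5 * (γ t).1 + ε)) hab
      ((hc _).sub (((hγ.ac_snd ha hb).add ((hγ.ac_fst ha hb).const_mul (4 / 5))).add (hc _))) ?_
    filter_upwards [hγ.ae_hasDerivAt] with t ht htm
    obtain ⟨k, hk, h1, h2⟩ := ht (ha.trans htm.1.le)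
    obtain rfl := hk.2.2 (h t htm)
    convert! ((h2.add (h1.const_mul (4 / 5))).add_const ε).const_sub 1 using 1
    ring

theorem IsFilippovSolution.eventually_snd_near
    (hγ : IsFilippovSolution (welanderField ε) Prod.snd (Ici 0) γ) {t : ℝ} (ht : 0 ≤ t)
    {P : ℝ × ℝ → Prop} (hP : ∀ᶠ q in 𝓝 (γ t), P q) :
    ∃ h > 0, ∀ s, 0 ≤ s → |s - t| < h → P (γ s) := by
  have h1 := (hγ.continuousOn t ht).eventually hP
  rw [eventually_nhdsWithin_iff, Metric.eventually_nhds_iff] at h1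
  obtain ⟨h, h0, h1⟩ := h1
  exact ⟨h, h0, fun s hs hst => h1 (by rwa [Real.dist_eq]) hs⟩

/-- A solution crosses `y = 0` upwards to the right of both tangency points. -/
theorem IsFilippovSolution.crossing_up
    (hγ : IsFilippovSolution (welanderField ε) Prod.snd (Ici 0) γ) {t : ℝ} (ht : 0 ≤ t)
    (h0 : (γ t).2 = 0) (h1 : 3 / 4 + 15 / 4 * ε < (γ t).1) (h2 : 3 / 4 + 5 / 4 * ε < (γ t).1) :
    ∃ h > 0, (∀ s ∈ Ioo t (t + h), 0 < (γ s).2) ∧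
      ∀ s ∈ Ioo (t - h) t, 0 ≤ s → (γ s).2 < 0 := by
  obtain ⟨m, hm, hm1, hm2⟩ : ∃ m > 0, m < (γ t).1 - (3 / 4 + 15 / 4 * ε) ∧
      m < (γ t).1 - (3 / 4 + 5 / 4 * ε) := by
    obtain ⟨m, hm, hm'⟩ := exists_between (lt_min (sub_pos.2 h1) (sub_pos.2 h2))
    exact ⟨m, hm, hm'.trans_le (min_le_left _ _), hm'.trans_le (min_le_right _ _)⟩
  -- The right-hand sides are ẏ for k = 1 and for k = 0. As ẏ is affine in k, every admissible
  -- velocity nearby has ẏ > 2m/5, whichever k a solution selects.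
  have hev : ∀ᶠ q : ℝ × ℝ in 𝓝 (γ t),
      2 / 5 * m < 2 / 5 * (q.1 - (3 / 4 + 15 / 4 * ε)) - 3 / 2 * q.2 ∧
      2 / 5 * m < 2 / 5 * (q.1 - (3 / 4 + 5 / 4 * ε)) - 1 / 2 * q.2 := by
    refine Eventually.and ?_ ?_
    · exact (continuous_const.continuousAt).eventually_lt (by fun_prop)
        (by simp only [h0]; linarith)
    · exact (continuous_const.continuousAt).eventually_lt (by fun_prop)
        (by simp only [h0]; linarith)
  obtain ⟨h, hh, hP⟩ := hγ.eventually_snd_near ht hev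
  have key : ∀ a b, 0 ≤ a → a < b → t - h < a → b < t + h → (γ a).2 < (γ b).2 := by
    intro a b ha hab hla hbl
    have hb := ha.trans hab.le
    have hle := AbsolutelyContinuousOnInterval.le_of_ae_deriv_nonpos
      (f := fun s => 2 / 5 * m * s - (γ s).2) hab.le
      (AbsolutelyContinuousOnInterval.sub (ContDiffOn.absolutelyContinuousOnInterval
        (ContDiff.contDiffOn (by fun_prop))) (hγ.ac_snd ha hb)) (by
        filter_upwards [hγ.ae_hasDerivAt] with s hs hsm
        obtain ⟨k, hk, -, hd⟩ := hs (ha.trans hsm.1.le)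
        have hd' := (((hasDerivAt_id s).const_mul (2 / 5 * m)).sub hd).deriv
        have hp := hP s (ha.trans hsm.1.le) (abs_lt.2 ⟨by linarith [hsm.1], by linarith [hsm.2]⟩)
        have e : deriv (fun s => 2 / 5 * m * s - (γ s).2) s = _ := hd'
        rw [e]
        nlinarith [hk.1.1, hk.1.2])
    beta_reduce at hle
    nlinarith [mul_pos hm (sub_pos.2 hab)]
  refine ⟨h, hh, fun s hs => ?_, fun s hs hs0 => ?_⟩
  · have := key t s ht hs.1 (by linarith) hs.2
    linarith
  · have := key s t hs0 hs.2 hs.1 (by linarith)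
    linarith

/-- A solution crosses `y = 0` downwards to the left of both tangency points. -/
theorem IsFilippovSolution.crossing_down
    (hγ : IsFilippovSolution (welanderField ε) Prod.snd (Ici 0) γ) {t : ℝ} (ht : 0 ≤ t)
    (h0 : (γ t).2 = 0) (h1 : (γ t).1 < 3 / 4 + 15 / 4 * ε) (h2 : (γ t).1 < 3 / 4 + 5 / 4 * ε) :
    ∃ h > 0, (∀ s ∈ Ioo t (t + h), (γ s).2 < 0) ∧
      ∀ s ∈ Ioo (t - h) t, 0 ≤ s → 0 < (γ s).2 := by
  obtain ⟨m, hm, hm1, hm2⟩ : ∃ m > 0, m < (3 / 4 + 15 / 4 * ε) - (γ t).1 ∧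
      m < (3 / 4 + 5 / 4 * ε) - (γ t).1 := by
    obtain ⟨m, hm, hm'⟩ := exists_between (lt_min (sub_pos.2 h1) (sub_pos.2 h2))
    exact ⟨m, hm, hm'.trans_le (min_le_left _ _), hm'.trans_le (min_le_right _ _)⟩
  have hev : ∀ᶠ q : ℝ × ℝ in 𝓝 (γ t),
      2 / 5 * m < 2 / 5 * ((3 / 4 + 15 / 4 * ε) - q.1) + 3 / 2 * q.2 ∧
      2 / 5 * m < 2 / 5 * ((3 / 4 + 5 / 4 * ε) - q.1) + 1 / 2 * q.2 := by
    refine Eventually.and ?_ ?_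
    · exact (continuous_const.continuousAt).eventually_lt (by fun_prop)
        (by simp only [h0]; linarith)
    · exact (continuous_const.continuousAt).eventually_lt (by fun_prop)
        (by simp only [h0]; linarith)
  obtain ⟨h, hh, hP⟩ := hγ.eventually_snd_near ht hev
  have key : ∀ a b, 0 ≤ a → a < b → t - h < a → b < t + h → (γ b).2 < (γ a).2 := by
    intro a b ha hab hla hbl
    have hb := ha.trans hab.le
    have hle := AbsolutelyContinuousOnInterval.le_of_ae_deriv_nonpos
      (f := fun s => 2 / 5 * m * s + (γ s).2) hab.le
      (AbsolutelyContinuousOnInterval.add (ContDiffOn.absolutelyContinuousOnInterval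
        (ContDiff.contDiffOn (by fun_prop))) (hγ.ac_snd ha hb)) (by
        filter_upwards [hγ.ae_hasDerivAt] with s hs hsm
        obtain ⟨k, hk, -, hd⟩ := hs (ha.trans hsm.1.le)
        have hd' := (((hasDerivAt_id s).const_mul (2 / 5 * m)).add hd).deriv
        have hp := hP s (ha.trans hsm.1.le) (abs_lt.2 ⟨by linarith [hsm.1], by linarith [hsm.2]⟩)
        have e : deriv (fun s => 2 / 5 * m * s + (γ s).2) s = _ := hd'
        rw [e]
        nlinarith [hk.1.1, hk.1.2])
    beta_reduce at hle
    nlinarith [mul_pos hm (sub_pos.2 hab)]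
  refine ⟨h, hh, fun s hs => ?_, fun s hs hs0 => ?_⟩
  · have := key t s ht hs.1 (by linarith) hs.2
    linarith
  · have := key s t hs0 hs.2 hs.1 (by linarith)
    linarith

end Solutions

/-! ### Asymptotic stability from a pair of one-sided Lyapunov functions. -/

/-- The minimum of f over the compact set where g ≥ η serves as δ. It is used both ways between the
distance to Γ and the Lyapunov functions. -/
theorem IsCompact.exists_pos_forall_lt {X : Type*} [TopologicalSpace X] {C : Set X}
    (hC : IsCompact C) {f g : X → ℝ} (hf : ContinuousOn f C) (hg : ContinuousOn g C)
    (h : ∀ q ∈ C, 0 < g q → 0 < f q) {η : ℝ} (hη : 0 < η) :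
    ∃ δ > 0, ∀ q ∈ C, f q < δ → g q < η := by
  have hC' : IsCompact {q ∈ C | η ≤ g q} := by
    obtain ⟨u, hu, hu'⟩ := continuousOn_iff_isClosed.1 hg (Ici η) isClosed_Ici
    have : {q ∈ C | η ≤ g q} = C ∩ u := by
      rw [inter_comm, ← hu', inter_comm]; rfl
    rw [this]
    exact hC.inter_right hu
  rcases {q ∈ C | η ≤ g q}.eq_empty_or_nonempty with he | hne
  · refine ⟨1, one_pos, fun q hq _ => not_le.1 fun hle => ?_⟩
    have : q ∈ {q ∈ C | η ≤ g q} := ⟨hq, hle⟩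
    rw [he] at this
    exact this
  · obtain ⟨q₀, hq₀, hmin⟩ := hC'.exists_isMinOn hne (hf.mono fun q hq => hq.1)
    refine ⟨f q₀, h q₀ hq₀.1 (hη.trans_le hq₀.2), fun q hq hlt => not_le.1 fun hle => ?_⟩
    exact absurd (hmin ⟨hq, hle⟩) (not_le.2 hlt)

/-- The function equal to `W₁` in `y > 0`, to `W₀` in `y < 0`, and to the smaller one on `y = 0`. -/
noncomputable def splitFun (W₁ W₀ : ℝ × ℝ → ℝ) (q : ℝ × ℝ) : ℝ :=
  if 0 < q.2 then W₁ q else if q.2 < 0 then W₀ q else min (W₁ q) (W₀ q)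

section splitFun

variable {W₁ W₀ : ℝ × ℝ → ℝ} {q : ℝ × ℝ}

theorem splitFun_of_pos (h : 0 < q.2) : splitFun W₁ W₀ q = W₁ q := if_pos h

theorem splitFun_of_neg (h : q.2 < 0) : splitFun W₁ W₀ q = W₀ q := by
  rw [splitFun, if_neg h.not_gt, if_pos h]

theorem splitFun_of_eq (h : q.2 = 0) : splitFun W₁ W₀ q = min (W₁ q) (W₀ q) := by
  rw [splitFun, if_neg (by simp [h]), if_neg (by simp [h])]

theorem splitFun_le_of_nonneg (h : 0 ≤ q.2) : splitFun W₁ W₀ q ≤ W₁ q := by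
  rcases h.eq_or_lt with h | h
  · rw [splitFun_of_eq h.symm]; exact min_le_left _ _
  · rw [splitFun_of_pos h]

theorem splitFun_le_of_nonpos (h : q.2 ≤ 0) : splitFun W₁ W₀ q ≤ W₀ q := by
  rcases h.eq_or_lt with h | h
  · rw [splitFun_of_eq h]; exact min_le_right _ _
  · rw [splitFun_of_neg h]

theorem splitFun_cases (W₁ W₀ : ℝ × ℝ → ℝ) (q : ℝ × ℝ) :
    (0 ≤ q.2 ∧ splitFun W₁ W₀ q = W₁ q) ∨ (q.2 ≤ 0 ∧ splitFun W₁ W₀ q = W₀ q) := by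
  rcases lt_trichotomy q.2 0 with h | h | h
  · exact Or.inr ⟨h.le, splitFun_of_neg h⟩
  · rw [splitFun_of_eq h]
    rcases le_total (W₁ q) (W₀ q) with h' | h'
    · exact Or.inl ⟨h.ge, min_eq_left h'⟩
    · exact Or.inr ⟨h.le, min_eq_right h'⟩
  · exact Or.inl ⟨h.le, splitFun_of_pos h⟩

end splitFun

/-- Local decrease of `splitFun W₁ W₀` along a solution, at a time where the solution is off the
switching line or crosses it in a direction in which `splitFun W₁ W₀` does not jump up. -/
theorem IsFilippovSolution.splitFun_local_decay {ε : ℝ} {γ : ℝ → ℝ × ℝ} {W₁ W₀ : ℝ × ℝ → ℝ}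
    (hγ : IsFilippovSolution (welanderField ε) Prod.snd (Ici 0) γ)
    (hd₁ : ∀ a b, 0 ≤ a → a ≤ b → (∀ t ∈ Ioo a b, 0 < (γ t).2) →
      W₁ (γ b) ≤ W₁ (γ a) * Real.exp (-(b - a)))
    (hd₀ : ∀ a b, 0 ≤ a → a ≤ b → (∀ t ∈ Ioo a b, (γ t).2 < 0) →
      W₀ (γ b) ≤ W₀ (γ a) * Real.exp (-(b - a)))
    {t : ℝ} (ht : 0 ≤ t)
    (hcross : (γ t).2 = 0 →
      (3 / 4 + 15 / 4 * ε < (γ t).1 ∧ 3 / 4 + 5 / 4 * ε < (γ t).1 ∧ W₁ (γ t) ≤ W₀ (γ t)) ∨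
      ((γ t).1 < 3 / 4 + 15 / 4 * ε ∧ (γ t).1 < 3 / 4 + 5 / 4 * ε ∧ W₀ (γ t) ≤ W₁ (γ t))) :
    ∃ h > 0, (∀ s ∈ Ioo t (t + h),
        splitFun W₁ W₀ (γ s) ≤ splitFun W₁ W₀ (γ t) * Real.exp (-(s - t))) ∧
      ∀ s ∈ Ioo (t - h) t, 0 ≤ s →
        splitFun W₁ W₀ (γ t) ≤ splitFun W₁ W₀ (γ s) * Real.exp (-(t - s)) := by
  rcases lt_trichotomy (γ t).2 0 with h0 | h0 | h0
  · obtain ⟨h, hh, hP⟩ := hγ.eventually_snd_near ht (P := fun q => q.2 < 0)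
      (continuous_snd.continuousAt.eventually_lt continuousAt_const h0)
    refine ⟨h, hh, fun s hs => ?_, fun s hs hs0 => ?_⟩
    · rw [splitFun_of_neg h0, splitFun_of_neg (hP s (ht.trans hs.1.le)
        (abs_lt.2 ⟨by linarith [hs.1], by linarith [hs.2]⟩))]
      exact hd₀ t s ht hs.1.le fun u hu => hP u (ht.trans hu.1.le)
        (abs_lt.2 ⟨by linarith [hu.1], by linarith [hu.2, hs.2]⟩)
    · rw [splitFun_of_neg h0, splitFun_of_neg (hP s hs0
        (abs_lt.2 ⟨by linarith [hs.1], by linarith [hs.2]⟩))]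
      exact hd₀ s t hs0 hs.2.le fun u hu => hP u (hs0.trans hu.1.le)
        (abs_lt.2 ⟨by linarith [hu.1, hs.1], by linarith [hu.2]⟩)
  · rcases hcross h0 with ⟨c1, c2, c3⟩ | ⟨c1, c2, c3⟩
    · obtain ⟨h, hh, hr, hl⟩ := hγ.crossing_up ht h0 c1 c2
      refine ⟨h, hh, fun s hs => ?_, fun s hs hs0 => ?_⟩
      -- On the line the minimum equals the value for the side being entered, so nothing jumps on
      -- leaving; on arrival it is at most the value for the side being left.
      · rw [splitFun_of_eq h0, min_eq_left c3, splitFun_of_pos (hr s hs)]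
        exact hd₁ t s ht hs.1.le fun u hu => hr u ⟨hu.1, hu.2.trans hs.2⟩
      · rw [splitFun_of_neg (hl s hs hs0)]
        exact (splitFun_le_of_nonpos h0.le).trans
          (hd₀ s t hs0 hs.2.le fun u hu => hl u ⟨hs.1.trans hu.1, hu.2⟩ (hs0.trans hu.1.le))
    · obtain ⟨h, hh, hr, hl⟩ := hγ.crossing_down ht h0 c1 c2
      refine ⟨h, hh, fun s hs => ?_, fun s hs hs0 => ?_⟩
      · rw [splitFun_of_eq h0, min_eq_right c3, splitFun_of_neg (hr s hs)]
        exact hd₀ t s ht hs.1.le fun u hu => hr u ⟨hu.1, hu.2.trans hs.2⟩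
      · rw [splitFun_of_pos (hl s hs hs0)]
        exact (splitFun_le_of_nonneg h0.ge).trans
          (hd₁ s t hs0 hs.2.le fun u hu => hl u ⟨hs.1.trans hu.1, hu.2⟩ (hs0.trans hu.1.le))
  · obtain ⟨h, hh, hP⟩ := hγ.eventually_snd_near ht (P := fun q => 0 < q.2)
      (continuousAt_const.eventually_lt continuous_snd.continuousAt h0)
    refine ⟨h, hh, fun s hs => ?_, fun s hs hs0 => ?_⟩
    · rw [splitFun_of_pos h0, splitFun_of_pos (hP s (ht.trans hs.1.le)
        (abs_lt.2 ⟨by linarith [hs.1], by linarith [hs.2]⟩))]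
      exact hd₁ t s ht hs.1.le fun u hu => hP u (ht.trans hu.1.le)
        (abs_lt.2 ⟨by linarith [hu.1], by linarith [hu.2, hs.2]⟩)
    · rw [splitFun_of_pos h0, splitFun_of_pos (hP s hs0
        (abs_lt.2 ⟨by linarith [hs.1], by linarith [hs.2]⟩))]
      exact hd₁ s t hs0 hs.2.le fun u hu => hP u (hs0.trans hu.1.le)
        (abs_lt.2 ⟨by linarith [hu.1, hs.1], by linarith [hu.2]⟩)

/-- A curve starting in `d < ρ` with `w < m` stays in `d < ρ` and `w` decays exponentially, if `w`
decays locally as long as `d ≤ ρ` and `w ≥ m` wherever `d = ρ`. -/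
theorem exp_decay_of_local_decay {d w : ℝ → ℝ} {ρ m : ℝ} (hd : ContinuousOn d (Ici 0))
    (hw : ∀ t, 0 ≤ w t) (hm : ∀ t, 0 ≤ t → d t = ρ → m ≤ w t)
    (hloc : ∀ t, 0 ≤ t → d t ≤ ρ → ∃ h > 0,
      (∀ s ∈ Ioo t (t + h), w s ≤ w t * Real.exp (-(s - t))) ∧
      ∀ s ∈ Ioo (t - h) t, 0 ≤ s → w t ≤ w s * Real.exp (-(t - s)))
    (h0 : d 0 < ρ) (hw0 : w 0 < m) :
    ∀ t, 0 ≤ t → d t < ρ ∧ w t ≤ w 0 * Real.exp (-t) := by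
  by_contra! hcon
  -- Continuous induction: B is the set of times at which the conclusion fails. It is shown to hold
  -- at s = inf B and on an interval to the right of s.
  let B := {t | 0 ≤ t ∧ (d t < ρ → w 0 * Real.exp (-t) < w t)}
  have hBne : B.Nonempty := hcon
  have hBbd : BddBelow B := ⟨0, fun t ht => ht.1⟩
  set s := sInf B with hs
  have hs0 : 0 ≤ s := le_csInf hBne fun t ht => ht.1
  have hbelow : ∀ t, 0 ≤ t → t < s → d t < ρ ∧ w t ≤ w 0 * Real.exp (-t) := by
    intro t ht hts
    by_contra hc
    push Not at hc
    exact absurd (csInf_le hBbd (show t ∈ B from ⟨ht, hc⟩)) (not_le.2 hts)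
  have hchain : ∀ a b : ℝ, w b ≤ w a * Real.exp (-(b - a)) → w a ≤ w 0 * Real.exp (-a) →
      w b ≤ w 0 * Real.exp (-b) := by
    intro a b h1 h2
    refine h1.trans ((mul_le_mul_of_nonneg_right h2 (Real.exp_pos _).le).trans_eq ?_)
    rw [mul_assoc, ← Real.exp_add]; ring_nf
  have hgood : d s < ρ ∧ w s ≤ w 0 * Real.exp (-s) := by
    rcases hs0.eq_or_lt with h | hpos
    · rw [← h]; simpa using h0
    · have hle : d s ≤ ρ := by
        have hcl : s ∈ closure (Ioo 0 s) := by
          rw [closure_Ioo hpos.ne]; exact ⟨hs0, le_rfl⟩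
        have hct : ContinuousWithinAt d (Ioo 0 s) s := (hd s hs0).mono fun t ht => ht.1.le
        exact hct.closure_le hcl continuousWithinAt_const
          fun t ht => (hbelow t ht.1.le ht.2).1.le
      obtain ⟨h, hh, -, hl⟩ := hloc s hs0 hle
      obtain ⟨t, ht1, ht2⟩ := exists_between (max_lt hpos (sub_lt_self s hh))
      have ht0 : 0 ≤ t := (le_max_left _ _).trans ht1.le
      have hws := hchain t s (hl t ⟨(le_max_right _ _).trans_lt ht1, ht2⟩ ht0) (hbelow t ht0 ht2).2
      -- The boundary d = ρ would force w s ≥ m, while the decay already gives w s ≤ w 0 < m.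
      refine ⟨lt_of_le_of_ne hle fun he => ?_, hws⟩
      have h1 := hm s hs0 he
      have h2 : Real.exp (-s) ≤ 1 := Real.exp_le_one_iff.2 (by linarith)
      nlinarith [hw 0]
  obtain ⟨h, hh, hr, -⟩ := hloc s hs0 hgood.1.le
  have hev : ∀ᶠ t in 𝓝[Ici 0] s, d t < ρ := (hd s hs0).eventually_lt continuousWithinAt_const hgood.1
  rw [eventually_nhdsWithin_iff, Metric.eventually_nhds_iff] at hev
  obtain ⟨h', hh', hev⟩ := hev
  obtain ⟨b, hb, hbs⟩ := exists_lt_of_csInf_lt hBne (show sInf B < s + min h h' by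
    have := lt_min hh hh'; linarith)
  have hsb : s ≤ b := csInf_le hBbd hb
  have hbh : b < s + h := hbs.trans_le (by linarith [min_le_left h h'])
  have hbh' : b < s + h' := hbs.trans_le (by linarith [min_le_right h h'])
  have hdb : d b < ρ := hev (by rw [Real.dist_eq, abs_lt]; constructor <;> linarith) hb.1
  refine absurd (hb.2 hdb) (not_lt.2 ?_)
  rcases hsb.eq_or_lt with he | hlt
  · rw [← he]; exact hgood.2
  · exact hchain s b (hr b ⟨hlt, hbh⟩) hgood.2

/-- A compact set `Γ` surrounded by crossing trajectories is asymptotically stable if there are a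
function `W₁` for `y ≥ 0` and a function `W₀` for `y ≤ 0`, vanishing on `Γ` only, that decay along
solutions and do not jump up where solutions pass from one to the other. -/
theorem isAsymptoticallyStable_of_splitFun {ε : ℝ} {Γ U : Set (ℝ × ℝ)} {W₁ W₀ : ℝ × ℝ → ℝ}
    (hΓ : IsCompact Γ) (hU : IsOpen U) (hΓU : Γ ⊆ U) (hΓne : Γ.Nonempty)
    (hc₁ : ContinuousOn W₁ U) (hc₀ : ContinuousOn W₀ U)
    (hp₁ : ∀ q, 0 ≤ W₁ q) (hp₀ : ∀ q, 0 ≤ W₀ q)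
    (hz₁ : ∀ q ∈ U, 0 ≤ q.2 → (W₁ q = 0 ↔ q ∈ Γ)) (hz₀ : ∀ q ∈ U, q.2 ≤ 0 → (W₀ q = 0 ↔ q ∈ Γ))
    (hd₁ : ∀ γ, IsFilippovSolution (welanderField ε) Prod.snd (Ici 0) γ → ∀ a b, 0 ≤ a → a ≤ b →
      (∀ t ∈ Ioo a b, 0 < (γ t).2) → W₁ (γ b) ≤ W₁ (γ a) * Real.exp (-(b - a)))
    (hd₀ : ∀ γ, IsFilippovSolution (welanderField ε) Prod.snd (Ici 0) γ → ∀ a b, 0 ≤ a → a ≤ b →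
      (∀ t ∈ Ioo a b, (γ t).2 < 0) → W₀ (γ b) ≤ W₀ (γ a) * Real.exp (-(b - a)))
    (hcross : ∀ q ∈ U, q.2 = 0 →
      (3 / 4 + 15 / 4 * ε < q.1 ∧ 3 / 4 + 5 / 4 * ε < q.1 ∧ W₁ q ≤ W₀ q) ∨
      (q.1 < 3 / 4 + 15 / 4 * ε ∧ q.1 < 3 / 4 + 5 / 4 * ε ∧ W₀ q ≤ W₁ q)) :
    IsAsymptoticallyStable (welanderField ε) Prod.snd Γ := by
  obtain ⟨ρ, hρ, hρU⟩ := hΓ.exists_cthickening_subset_open hU hΓU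
  have hmem : ∀ q, Metric.infDist q Γ ≤ ρ → q ∈ Metric.cthickening ρ Γ := fun q hq => by
    obtain ⟨p, hp, hpq⟩ := hΓ.exists_infDist_eq_dist hΓne q
    exact Metric.mem_cthickening_of_dist_le q p ρ Γ hp (hpq ▸ hq)
  have hK : IsCompact (Metric.cthickening ρ Γ) := hΓ.cthickening
  have hK₁ : IsCompact (Metric.cthickening ρ Γ ∩ {q | 0 ≤ q.2}) :=
    hK.inter_right (isClosed_le continuous_const continuous_snd)
  have hK₀ : IsCompact (Metric.cthickening ρ Γ ∩ {q | q.2 ≤ 0}) :=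
    hK.inter_right (isClosed_le continuous_snd continuous_const)
  have hK₁U : Metric.cthickening ρ Γ ∩ {q | 0 ≤ q.2} ⊆ U := inter_subset_left.trans hρU
  have hK₀U : Metric.cthickening ρ Γ ∩ {q | q.2 ≤ 0} ⊆ U := inter_subset_left.trans hρU
  have hdc : Continuous fun q => Metric.infDist q Γ := Metric.continuous_infDist_pt Γ
  have hpos : ∀ q, 0 < Metric.infDist q Γ ↔ q ∉ Γ := fun q => by
    rw [← hΓ.isClosed.notMem_iff_infDist_pos hΓne]
  have hWnn : ∀ q, 0 ≤ splitFun W₁ W₀ q := fun q => by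
    rcases splitFun_cases W₁ W₀ q with h | h <;> rw [h.2]
    exacts [hp₁ q, hp₀ q]
  have small : ∀ η > 0, ∃ m > 0, ∀ q ∈ Metric.cthickening ρ Γ,
      splitFun W₁ W₀ q < m → Metric.infDist q Γ < η := by
    intro η hη
    obtain ⟨m₁, hm₁, h₁⟩ := hK₁.exists_pos_forall_lt (hc₁.mono hK₁U) hdc.continuousOn
      (fun q hq hq' => (hp₁ q).lt_of_ne' fun h =>
        (hpos q).1 hq' ((hz₁ q (hK₁U hq) hq.2).1 h)) hη
    obtain ⟨m₀, hm₀, h₀⟩ := hK₀.exists_pos_forall_lt (hc₀.mono hK₀U) hdc.continuousOn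
      (fun q hq hq' => (hp₀ q).lt_of_ne' fun h =>
        (hpos q).1 hq' ((hz₀ q (hK₀U hq) hq.2).1 h)) hη
    refine ⟨min m₁ m₀, lt_min hm₁ hm₀, fun q hq hlt => ?_⟩
    rcases splitFun_cases W₁ W₀ q with h | h <;> rw [h.2] at hlt
    · exact h₁ q ⟨hq, h.1⟩ (hlt.trans_le (min_le_left _ _))
    · exact h₀ q ⟨hq, h.1⟩ (hlt.trans_le (min_le_right _ _))
  have close : ∀ m > 0, ∃ δ > 0, ∀ q ∈ Metric.cthickening ρ Γ,
      Metric.infDist q Γ < δ → splitFun W₁ W₀ q < m := by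
    intro m hm
    obtain ⟨δ₁, hδ₁, h₁⟩ := hK₁.exists_pos_forall_lt hdc.continuousOn (hc₁.mono hK₁U)
      (fun q hq hq' => (hpos q).2 fun h => hq'.ne' ((hz₁ q (hK₁U hq) hq.2).2 h)) hm
    obtain ⟨δ₀, hδ₀, h₀⟩ := hK₀.exists_pos_forall_lt hdc.continuousOn (hc₀.mono hK₀U)
      (fun q hq hq' => (hpos q).2 fun h => hq'.ne' ((hz₀ q (hK₀U hq) hq.2).2 h)) hm
    refine ⟨min δ₁ δ₀, lt_min hδ₁ hδ₀, fun q hq hlt => ?_⟩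
    rcases splitFun_cases W₁ W₀ q with h | h <;> rw [h.2]
    · exact h₁ q ⟨hq, h.1⟩ (hlt.trans_le (min_le_left _ _))
    · exact h₀ q ⟨hq, h.1⟩ (hlt.trans_le (min_le_right _ _))
  -- The level m is the barrier: a value below m excludes distance exactly ρ, so a solution that
  -- starts inside below this level cannot leave the tube.
  obtain ⟨m, hm, hmρ⟩ := small ρ hρ
  have trap : ∀ m' ≤ m, ∀ γ, IsFilippovSolution (welanderField ε) Prod.snd (Ici 0) γ →
      Metric.infDist (γ 0) Γ < ρ → splitFun W₁ W₀ (γ 0) < m' → ∀ t, 0 ≤ t →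
      Metric.infDist (γ t) Γ < ρ ∧
        splitFun W₁ W₀ (γ t) ≤ splitFun W₁ W₀ (γ 0) * Real.exp (-t) := by
    intro m' hm' γ hγ hd0 hw0
    refine exp_decay_of_local_decay (d := fun t => Metric.infDist (γ t) Γ)
      (w := fun t => splitFun W₁ W₀ (γ t)) (m := m) (hdc.comp_continuousOn hγ.continuousOn)
      (fun t => hWnn _) (fun t ht he => ?_) (fun t ht hle => ?_) hd0 (hw0.trans_le hm')
    · by_contra hlt
      exact (hmρ (γ t) (hmem _ he.le) (not_le.1 hlt)).ne he
    · exact hγ.splitFun_local_decay (hd₁ γ hγ) (hd₀ γ hγ) ht (hcross _ (hρU (hmem _ hle)))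
  refine ⟨fun η hη => ?_, ?_⟩
  · obtain ⟨m', hm', hη'⟩ := small η hη
    obtain ⟨δ, hδ, hclose⟩ := close (min m m') (lt_min hm hm')
    refine ⟨min δ ρ, lt_min hδ hρ, fun γ hγ h0 t ht => ?_⟩
    have hρ0 := h0.trans_le (min_le_right _ _)
    have hw0 := hclose (γ 0) (hmem _ hρ0.le) (h0.trans_le (min_le_left _ _))
    obtain ⟨h1, h2⟩ := trap _ (min_le_left _ _) γ hγ hρ0 hw0 t ht
    refine hη' (γ t) (hmem _ h1.le) (lt_of_le_of_lt (h2.trans ?_)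
      (hw0.trans_le (min_le_right _ _)))
    exact mul_le_of_le_one_right (hWnn _) (Real.exp_le_one_iff.2 (by linarith))
  · obtain ⟨δ, hδ, hclose⟩ := close m hm
    refine ⟨min δ ρ, lt_min hδ hρ, fun γ hγ h0 => ?_⟩
    have hρ0 := h0.trans_le (min_le_right _ _)
    have hw0 := hclose (γ 0) (hmem _ hρ0.le) (h0.trans_le (min_le_left _ _))
    have htrap := trap m le_rfl γ hγ hρ0 hw0
    have hlim : Tendsto (fun t => splitFun W₁ W₀ (γ 0) * Real.exp (-t)) atTop (𝓝 0) := by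
      simpa using Real.tendsto_exp_neg_atTop_nhds_zero.const_mul (splitFun W₁ W₀ (γ 0))
    rw [Metric.tendsto_nhds]
    intro η hη
    obtain ⟨m', hm', hη'⟩ := small η hη
    filter_upwards [hlim.eventually_lt_const hm', eventually_ge_atTop 0] with t ht ht0
    rw [Real.dist_eq, sub_zero, abs_of_nonneg Metric.infDist_nonneg]
    exact hη' _ (hmem _ (htrap t ht0).1.le) ((htrap t ht0).2.trans_lt ht)

/-! ### Periodic extension of a closed trajectory. -/

theorem LipschitzOnWith.Icc_union {E : Type*} [PseudoMetricSpace E] {g : ℝ → E} {a b c : ℝ}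
    {K : NNReal} (h₁ : LipschitzOnWith K g (Icc a b)) (h₂ : LipschitzOnWith K g (Icc b c)) :
    LipschitzOnWith K g (Icc a c) := by
  have key : ∀ s ∈ Icc a c, ∀ t ∈ Icc a c, s ≤ t → dist (g s) (g t) ≤ K * dist s t := by
    intro s hs t ht hst
    rcases le_total t b with htb | htb
    · exact h₁.dist_le_mul s ⟨hs.1, hst.trans htb⟩ t ⟨ht.1, htb⟩
    rcases le_total b s with hsb | hsb
    · exact h₂.dist_le_mul s ⟨hsb, hs.2⟩ t ⟨hsb.trans hst, ht.2⟩
    have e1 := h₁.dist_le_mul s ⟨hs.1, hsb⟩ b ⟨hs.1.trans hsb, le_rfl⟩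
    have e2 := h₂.dist_le_mul b ⟨le_rfl, htb.trans ht.2⟩ t ⟨htb, ht.2⟩
    have e3 := dist_triangle (g s) (g b) (g t)
    rw [Real.dist_eq, abs_sub_comm, abs_of_nonneg (by linarith)] at *
    nlinarith
  refine LipschitzOnWith.of_dist_le_mul fun s hs t ht => ?_
  rcases le_total s t with h | h
  · exact key s hs t ht h
  · rw [dist_comm, dist_comm s t]; exact key t ht s hs h

/-- A closed trajectory over one period extends to a periodic Filippov solution. -/
theorem exists_periodic_filippovSolution {E : Type*} [NormedAddCommGroup E] [NormedSpace ℝ E]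
    {f : E → ℝ → E} {h : E → ℝ} {g : ℝ → E} {T : ℝ} (hT : 0 < T) {K : NNReal}
    (hg : LipschitzOnWith K g (Icc 0 T)) (h0 : g 0 = g T) {C : Set ℝ} (hC : C.Countable)
    (hd : ∀ t ∈ Ioo 0 T, t ∉ C → ∃ v ∈ filippovSet f h (g t), HasDerivAt g v t) :
    ∃ γ, IsFilippovSolution f h univ γ ∧ Function.Periodic γ T ∧ range γ = g '' Icc 0 T := by
  set γ : ℝ → E := fun t => g (T * Int.fract (t / T)) with hγ
  have hfr : ∀ t, T * Int.fract (t / T) = t - ⌊t / T⌋ * T := fun t => by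
    rw [Int.fract]; field_simp
  have hmem : ∀ t, T * Int.fract (t / T) ∈ Icc 0 T := fun t =>
    ⟨mul_nonneg hT.le (Int.fract_nonneg _), mul_le_of_le_one_right hT.le (Int.fract_lt_one _).le⟩
  have key : ∀ s t, s ≤ t → dist (γ s) (γ t) ≤ K * dist s t := by
    intro s t hst
    have hfl : ⌊s / T⌋ ≤ ⌊t / T⌋ := Int.floor_mono (by gcongr)
    rcases hfl.eq_or_lt with he | hlt
    · refine (hg.dist_le_mul _ (hmem s) _ (hmem t)).trans_eq ?_
      rw [hfr, hfr, he, Real.dist_eq, Real.dist_eq]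
      congr 2; ring
    · have e1 := hg.dist_le_mul _ (hmem s) T ⟨hT.le, le_rfl⟩
      have e2 := hg.dist_le_mul 0 ⟨le_rfl, hT.le⟩ _ (hmem t)
      have e3 := dist_triangle (γ s) (g T) (γ t)
      have e4 : dist (γ s) (g T) = dist (g (T * Int.fract (s / T))) (g T) := rfl
      have e5 : dist (g T) (γ t) = dist (g 0) (g (T * Int.fract (t / T))) := by rw [h0]
      have hlt' : ((⌊s / T⌋ : ℤ) : ℝ) + 1 ≤ ⌊t / T⌋ := by exact_mod_cast hlt
      have hm := (hmem s).2
      have hm' := (hmem t).1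
      rw [Real.dist_eq, abs_sub_comm, abs_of_nonneg (by linarith), hfr] at e1
      rw [Real.dist_eq, abs_sub_comm, abs_of_nonneg (by linarith), hfr] at e2
      rw [Real.dist_eq, abs_sub_comm, abs_of_nonneg (by linarith)]
      -- The rest of the period of s plus the elapsed part of the period of t is at most t - s.
      -- Whole periods in between cost nothing, and g 0 = g T closes the gap.
      have e6 : (K : ℝ) * (T - (s - ⌊s / T⌋ * T)) + K * (t - ⌊t / T⌋ * T - 0) ≤ K * (t - s) := by
        rw [← mul_add]
        refine mul_le_mul_of_nonneg_left ?_ K.2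
        nlinarith
      rw [hfr] at e4 e5
      linarith
  have hLip : LipschitzWith K γ := LipschitzWith.of_dist_le_mul fun s t => by
    rcases le_total s t with hst | hst
    · exact key s t hst
    · rw [dist_comm, dist_comm s t]; exact key t s hst
  refine ⟨γ, ⟨fun a b _ => (hLip.lipschitzOnWith).absolutelyContinuousOnInterval, ?_⟩, ?_, ?_⟩
  · rw [Measure.restrict_univ]
    -- Differentiability may fail at translates of C and at the junctions of periods, which form a
    -- countable, hence null, set.
    have hcount : (⋃ n : ℤ, (fun c => c + n * T) '' (insert 0 C)).Countable :=
      countable_iUnion fun n => (hC.insert 0).image _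
    filter_upwards [hcount.ae_notMem volume] with t ht
    simp only [mem_iUnion, not_exists] at ht
    have ht' : T * Int.fract (t / T) ∉ insert 0 C := fun hc =>
      ht ⌊t / T⌋ ⟨_, hc, by rw [hfr]; ring⟩
    rw [mem_insert_iff, not_or] at ht'
    have hIoo : T * Int.fract (t / T) ∈ Ioo 0 T :=
      ⟨lt_of_le_of_ne (hmem t).1 (Ne.symm ht'.1),
        mul_lt_of_lt_one_right hT (Int.fract_lt_one _)⟩
    obtain ⟨v, hv, hv'⟩ := hd _ hIoo ht'.2
    refine ⟨v, hv, ?_⟩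
    rw [hfr] at hv' hIoo
    refine (hv'.comp_sub_const t (⌊t / T⌋ * T)).congr_of_eventuallyEq ?_
    have hnhds : Ioo (⌊t / T⌋ * T) ((⌊t / T⌋ + 1) * T) ∈ 𝓝 t :=
      Ioo_mem_nhds (by linarith [hIoo.1]) (by linarith [hIoo.2])
    filter_upwards [hnhds] with s hs
    have hfs : ⌊s / T⌋ = ⌊t / T⌋ := by
      rw [Int.floor_eq_iff]
      constructor
      · rw [le_div_iff₀ hT]; exact hs.1.le
      · rw [div_lt_iff₀ hT]; exact hs.2
    simp only [hγ]
    rw [hfr, hfs]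
  · intro t
    simp only [hγ]
    rw [add_div, div_self hT.ne', Int.fract_add_one]
  · ext p
    constructor
    · rintro ⟨t, rfl⟩
      exact ⟨_, hmem t, rfl⟩
    · rintro ⟨s, hs, rfl⟩
      rcases hs.2.eq_or_lt with he | hlt
      · exact ⟨0, by simp [hγ, he, h0]⟩
      · refine ⟨s, ?_⟩
        simp only [hγ]
        rw [hfr, Int.floor_eq_zero_iff.2 ⟨by have := hs.1; positivity, (div_lt_one hT).2 hlt⟩]
        simp

/-! ### Two-arc cycles: geometry of the arcs and transversality of the crossings. -/

/-- Both functions vanish at a, so comparing their slopes compares the functions. This is applied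
along y = 0 at the crossings, where both Lyapunov functions of the cycle vanish. -/
theorem eventually_abs_le_abs_of_hasDerivAt {f g : ℝ → ℝ} {a f' g' : ℝ} (hf : HasDerivAt f f' a)
    (hg : HasDerivAt g g' a) (hfa : f a = 0) (hga : g a = 0) (h : |f'| < |g'|) :
    ∀ᶠ x in 𝓝 a, |f x| ≤ |g x| := by
  have h1 := (hasDerivAt_iff_tendsto_slope.1 hf).abs.eventually_lt
    (hasDerivAt_iff_tendsto_slope.1 hg).abs h
  rw [eventually_nhdsWithin_iff] at h1
  filter_upwards [h1] with x hx
  rcases eq_or_ne x a with rfl | hne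
  · rw [hfa, hga]
  · have h2 := hx hne
    rw [slope_def_field, slope_def_field, hfa, hga, abs_div, abs_div,
      div_lt_div_iff_of_pos_right (abs_pos.2 (sub_ne_zero.2 hne))] at h2
    simpa using h2.le

/-- Data of a cycle of the switched flow that consists of one arc in `y ≥ 0` and one in `y ≤ 0`:
in the upper arc `T - 1/2` decreases from `ξ` to `ξ q⁴` and `S - 1/3` from `σ` to `σ q³`, in the
lower arc `1 - T` decreases from `X` to `X r²` and `1 - S` from `Y` to `Y r`. -/
structure IsTwoArcCycle (ε ξ σ X Y q r : ℝ) : Prop where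
  ξ_pos : 0 < ξ
  σ_pos : 0 < σ
  X_pos : 0 < X
  Y_pos : 0 < Y
  q_pos : 0 < q
  q_lt : q < 1
  r_pos : 0 < r
  r_lt : r < 1
  right_fst : 1 / 2 + ξ = 1 - X * r ^ 2
  left_fst : 1 / 2 + ξ * q ^ 4 = 1 - X
  right_upper : 1 / 3 + σ = 4 / 5 * (1 / 2 + ξ) + ε
  right_lower : 1 - Y * r = 4 / 5 * (1 - X * r ^ 2) + ε
  left_upper : 1 / 3 + σ * q ^ 3 = 4 / 5 * (1 / 2 + ξ * q ^ 4) + ε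
  left_lower : 1 - Y = 4 / 5 * (1 - X) + ε

/-- The arc of the cycle in `y ≥ 0`. -/
noncomputable def upperArc (ε ξ σ θ : ℝ) : ℝ × ℝ :=
  (1 / 2 + ξ * θ ^ 4, 1 / 3 + σ * θ ^ 3 - 4 / 5 * (1 / 2 + ξ * θ ^ 4) - ε)

/-- The arc of the cycle in `y ≤ 0`. -/
noncomputable def lowerArc (ε X Y θ : ℝ) : ℝ × ℝ :=
  (1 - X * θ ^ 2, 1 - Y * θ - 4 / 5 * (1 - X * θ ^ 2) - ε)

/-- The two-arc cycle. -/
def twoArcCycle (ε ξ σ X Y q r : ℝ) : Set (ℝ × ℝ) :=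
  upperArc ε ξ σ '' Icc q 1 ∪ lowerArc ε X Y '' Icc r 1

theorem continuous_upperArc (ε ξ σ : ℝ) : Continuous (upperArc ε ξ σ) := by
  unfold upperArc; fun_prop

theorem continuous_lowerArc (ε X Y : ℝ) : Continuous (lowerArc ε X Y) := by
  unfold lowerArc; fun_prop

namespace IsTwoArcCycle

variable {ε ξ σ X Y q r : ℝ}

theorem Y_eq (h : IsTwoArcCycle ε ξ σ X Y q r) : Y = 4 / 5 * X * (1 + r) := by
  have h1 : 0 < 1 - r := by linarith [h.r_lt]
  have h2 : (1 - r) * Y = (1 - r) * (4 / 5 * X * (1 + r)) := by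
    linear_combination h.right_lower - h.left_lower
  exact mul_left_cancel₀ h1.ne' h2

theorem σ_mul (h : IsTwoArcCycle ε ξ σ X Y q r) :
    σ * (1 + q + q ^ 2) = 4 / 5 * ξ * (1 + q + q ^ 2 + q ^ 3) := by
  have h1 : 0 < 1 - q := by linarith [h.q_lt]
  refine mul_left_cancel₀ h1.ne' ?_
  linear_combination h.right_upper - h.left_upper

theorem upperArc_one (h : IsTwoArcCycle ε ξ σ X Y q r) :
    upperArc ε ξ σ 1 = (1 / 2 + ξ, 0) := by
  have := h.right_upper
  simp only [upperArc, Prod.mk.injEq]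
  constructor <;> linarith

theorem upperArc_q (h : IsTwoArcCycle ε ξ σ X Y q r) :
    upperArc ε ξ σ q = (1 - X, 0) := by
  have := h.left_upper
  have := h.left_fst
  simp only [upperArc, Prod.mk.injEq]
  constructor <;> linarith

theorem lowerArc_one (h : IsTwoArcCycle ε ξ σ X Y q r) :
    lowerArc ε X Y 1 = (1 - X, 0) := by
  have := h.left_lower
  simp only [lowerArc, Prod.mk.injEq]
  constructor <;> linarith

theorem lowerArc_r (h : IsTwoArcCycle ε ξ σ X Y q r) :
    lowerArc ε X Y r = (1 / 2 + ξ, 0) := by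
  have := h.right_lower
  have := h.right_fst
  simp only [lowerArc, Prod.mk.injEq]
  constructor <;> linarith

/-- As a polynomial in θ, the height y vanishes at the crossing values q and 1, and its cofactor is
positive for θ > 0. Hence the sign of y alone tells whether a point of the full orbit belongs to the
arc. -/
theorem upperArc_snd (h : IsTwoArcCycle ε ξ σ X Y q r) (θ : ℝ) :
    (upperArc ε ξ σ θ).2 * (1 + q + q ^ 2) = (1 - θ) * (θ - q) *
      (4 / 5 * ξ * (θ ^ 2 + θ * q + q ^ 2 + q * θ * (θ + q) + q ^ 2 * θ ^ 2)) := by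
  simp only [upperArc]
  linear_combination (1 + q + q ^ 2) * h.right_upper + (θ ^ 3 - 1) * h.σ_mul

theorem lowerArc_snd (h : IsTwoArcCycle ε ξ σ X Y q r) (θ : ℝ) :
    (lowerArc ε X Y θ).2 = -(1 - θ) * (θ - r) * (4 / 5 * X) := by
  simp only [lowerArc]
  linear_combination h.left_lower + (1 - θ) * h.Y_eq

theorem factor_pos (h : IsTwoArcCycle ε ξ σ X Y q r) {θ : ℝ} (hθ : 0 < θ) :
    0 < 4 / 5 * ξ * (θ ^ 2 + θ * q + q ^ 2 + q * θ * (θ + q) + q ^ 2 * θ ^ 2) := by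
  have := h.q_pos
  have := h.ξ_pos
  positivity

theorem upperArc_snd_nonneg_iff (h : IsTwoArcCycle ε ξ σ X Y q r) {θ : ℝ} (hθ : 0 < θ) :
    0 ≤ (upperArc ε ξ σ θ).2 ↔ θ ∈ Icc q 1 := by
  have hq := h.q_pos
  have hD : 0 < 1 + q + q ^ 2 := by positivity
  rw [← mul_nonneg_iff_of_pos_right hD, h.upperArc_snd, mul_nonneg_iff_of_pos_right (h.factor_pos hθ)]
  constructor
  · intro h1
    constructor <;> nlinarith [h.q_lt]
  · rintro ⟨h1, h2⟩
    nlinarith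

theorem upperArc_snd_pos (h : IsTwoArcCycle ε ξ σ X Y q r) {θ : ℝ} (hθ : θ ∈ Ioo q 1) :
    0 < (upperArc ε ξ σ θ).2 := by
  have hq := h.q_pos
  have hD : 0 < 1 + q + q ^ 2 := by positivity
  rw [← mul_pos_iff_of_pos_right hD, h.upperArc_snd]
  have := h.factor_pos (hq.trans hθ.1)
  exact mul_pos (mul_pos (by linarith [hθ.2]) (by linarith [hθ.1])) this

theorem lowerArc_snd_nonpos_iff (h : IsTwoArcCycle ε ξ σ X Y q r) {θ : ℝ} :
    (lowerArc ε X Y θ).2 ≤ 0 ↔ θ ∈ Icc r 1 := by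
  have hX : 0 < 4 / 5 * X := by linarith [h.X_pos]
  rw [h.lowerArc_snd, neg_mul, neg_mul, neg_nonpos, mul_nonneg_iff_of_pos_right hX]
  constructor
  · intro h1
    constructor <;> nlinarith [h.r_lt]
  · rintro ⟨h1, h2⟩
    nlinarith

theorem lowerArc_snd_neg (h : IsTwoArcCycle ε ξ σ X Y q r) {θ : ℝ} (hθ : θ ∈ Ioo r 1) :
    (lowerArc ε X Y θ).2 < 0 := by
  have hX : 0 < 4 / 5 * X := by linarith [h.X_pos]
  rw [h.lowerArc_snd]
  have := mul_pos (mul_pos (sub_pos.2 hθ.2) (sub_pos.2 hθ.1)) hX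
  linarith

theorem isCompact (ε ξ σ X Y q r : ℝ) : IsCompact (twoArcCycle ε ξ σ X Y q r) :=
  (isCompact_Icc.image (continuous_upperArc ε ξ σ)).union
    (isCompact_Icc.image (continuous_lowerArc ε X Y))

theorem mem_upperArc (h : IsTwoArcCycle ε ξ σ X Y q r) {p : ℝ × ℝ}
    (hp : p ∈ twoArcCycle ε ξ σ X Y q r) (h0 : 0 ≤ p.2) : ∃ θ ∈ Icc q 1, upperArc ε ξ σ θ = p := by
  rcases hp with hp | ⟨θ, hθ, rfl⟩
  · exact hp
  · rcases hθ.1.eq_or_lt with rfl | h1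
    · exact ⟨1, ⟨h.q_lt.le, le_rfl⟩, by rw [h.upperArc_one, h.lowerArc_r]⟩
    rcases hθ.2.eq_or_lt with rfl | h2
    · exact ⟨q, ⟨le_rfl, h.q_lt.le⟩, by rw [h.upperArc_q, h.lowerArc_one]⟩
    · exact absurd h0 (not_le.2 (h.lowerArc_snd_neg ⟨h1, h2⟩))

theorem mem_lowerArc (h : IsTwoArcCycle ε ξ σ X Y q r) {p : ℝ × ℝ}
    (hp : p ∈ twoArcCycle ε ξ σ X Y q r) (h0 : p.2 ≤ 0) : ∃ θ ∈ Icc r 1, lowerArc ε X Y θ = p := by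
  rcases hp with ⟨θ, hθ, rfl⟩ | hp
  · rcases hθ.1.eq_or_lt with rfl | h1
    · exact ⟨1, ⟨h.r_lt.le, le_rfl⟩, by rw [h.upperArc_q, h.lowerArc_one]⟩
    rcases hθ.2.eq_or_lt with rfl | h2
    · exact ⟨r, ⟨le_rfl, h.r_lt.le⟩, by rw [h.upperArc_one, h.lowerArc_r]⟩
    · exact absurd h0 (not_le.2 (h.upperArc_snd_pos ⟨h1, h2⟩))
  · exact hp

theorem snd_eq_zero (h : IsTwoArcCycle ε ξ σ X Y q r) {p : ℝ × ℝ}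
    (hp : p ∈ twoArcCycle ε ξ σ X Y q r) (h0 : p.2 = 0) :
    p = (1 / 2 + ξ, 0) ∨ p = (1 - X, 0) := by
  obtain ⟨θ, hθ, rfl⟩ := h.mem_lowerArc hp h0.le
  rcases hθ.1.eq_or_lt with rfl | h1
  · exact Or.inl h.lowerArc_r
  rcases hθ.2.eq_or_lt with rfl | h2
  · exact Or.inr h.lowerArc_one
  · exact absurd h0 (h.lowerArc_snd_neg ⟨h1, h2⟩).ne

/-- Eliminating ε reduces the claim to 15σ < 16ξ, which follows from `σ_mul` because q < 1. Together
with its three companions it shows that both fields cross y = 0 in the same direction at each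
crossing, so the cycle avoids the sliding region. -/
theorem right_tangency_upper (h : IsTwoArcCycle ε ξ σ X Y q r) :
    3 / 4 + 15 / 4 * ε < 1 / 2 + ξ := by
  have hq := h.q_pos
  have hD : 0 < 1 + q + q ^ 2 := by positivity
  have h1 : 0 < (16 * ξ - 15 * σ) * (1 + q + q ^ 2) := by
    have : (16 * ξ - 15 * σ) * (1 + q + q ^ 2) =
        4 * ξ * ((1 - q ^ 3) + q * (1 - q ^ 2) + q ^ 2 * (1 - q)) := by
      linear_combination -15 * h.σ_mul
    rw [this]
    have h3 : 0 < 1 - q ^ 3 := by nlinarith [h.q_lt]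
    have h2 : 0 < 1 - q ^ 2 := by nlinarith [h.q_lt]
    have h1 : 0 < 1 - q := by linarith [h.q_lt]
    have := h.ξ_pos
    positivity
  have h2 := (mul_pos_iff_of_pos_right hD).1 h1
  linarith [h.right_upper]

theorem right_tangency_lower (h : IsTwoArcCycle ε ξ σ X Y q r) :
    3 / 4 + 5 / 4 * ε < 1 / 2 + ξ := by
  have h1 : 0 < r * X * (1 - r) := mul_pos (mul_pos h.r_pos h.X_pos) (by linarith [h.r_lt])
  have h2 : 1 / 2 + ξ - (3 / 4 + 5 / 4 * ε) = r * X * (1 - r) := by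
    linear_combination h.right_fst + 5 / 4 * h.right_lower + 5 / 4 * r * h.Y_eq
  linarith

theorem left_tangency_upper (h : IsTwoArcCycle ε ξ σ X Y q r) :
    1 - X < 3 / 4 + 15 / 4 * ε := by
  have hq := h.q_pos
  have hD : 0 < 1 + q + q ^ 2 := by positivity
  have h1 : 0 < q ^ 3 * (15 * σ - 16 * ξ * q) * (1 + q + q ^ 2) := by
    have : q ^ 3 * (15 * σ - 16 * ξ * q) * (1 + q + q ^ 2) =
        4 * ξ * q ^ 3 * ((1 - q) + (1 - q) * (1 + q) + (1 - q ^ 3)) := by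
      linear_combination 15 * q ^ 3 * h.σ_mul
    rw [this]
    have h3 : 0 < 1 - q ^ 3 := by nlinarith [h.q_lt]
    have h1 : 0 < 1 - q := by linarith [h.q_lt]
    have := h.ξ_pos
    positivity
  have h2 := (mul_pos_iff_of_pos_right hD).1 h1
  linarith [h.left_upper, h.left_fst]

theorem left_tangency_lower (h : IsTwoArcCycle ε ξ σ X Y q r) :
    1 - X < 3 / 4 + 5 / 4 * ε := by
  have h1 : 0 < X * (1 - r) := mul_pos h.X_pos (by linarith [h.r_lt])
  have h2 : 1 - X - (3 / 4 + 5 / 4 * ε) = -(X * (1 - r)) := by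
    linear_combination 5 / 4 * h.left_lower + 5 / 4 * h.Y_eq
  linarith

end IsTwoArcCycle

/-! ### Lyapunov functions and asymptotic stability of a two-arc cycle. -/

/-- A function of modulus decreasing along the flow of `k = 1`, zero on the curve
`(T - 1/2)³ = C (S - 1/3)⁴`. -/
noncomputable def upperLyapunov (ε C : ℝ) (p : ℝ × ℝ) : ℝ :=
  |p.1 - 1 / 2 - C * (p.2 + 4 / 5 * p.1 + ε - 1 / 3) ^ 4 / (p.1 - 1 / 2) ^ 2|

/-- A function of modulus decreasing along the flow of `k = 0`, zero on the curve
`1 - T = C (1 - S)²`. -/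
noncomputable def lowerLyapunov (ε C κ : ℝ) (p : ℝ × ℝ) : ℝ :=
  |κ * (1 - p.1 - C * (1 - (p.2 + 4 / 5 * p.1 + ε)) ^ 2)|

theorem IsFilippovSolution.upperLyapunov_le {ε : ℝ} {γ : ℝ → ℝ × ℝ} (C : ℝ)
    (hγ : IsFilippovSolution (welanderField ε) Prod.snd (Ici 0) γ) {a b : ℝ} (ha : 0 ≤ a)
    (hab : a ≤ b) (h : ∀ t ∈ Ioo a b, 0 < (γ t).2) :
    upperLyapunov ε C (γ b) ≤ upperLyapunov ε C (γ a) * Real.exp (-(b - a)) := by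
  obtain ⟨h1, h2⟩ := hγ.flow_of_pos ha hab h
  have e1 : Real.exp (-2 * (b - a)) = Real.exp (-(b - a)) ^ 2 := by
    rw [← Real.exp_nat_mul]; congr 1; push_cast; ring
  have e2 : Real.exp (-(3 / 2) * (b - a)) ^ 4 = Real.exp (-(b - a)) ^ 6 := by
    rw [← Real.exp_nat_mul, ← Real.exp_nat_mul]; congr 1; push_cast; ring
  have hE : 0 < Real.exp (-(b - a)) := Real.exp_pos _
  have hE1 : Real.exp (-(b - a)) ≤ 1 := Real.exp_le_one_iff.2 (by linarith)
  rw [upperLyapunov, h1, h2, mul_pow _ _ 4, e2, e1, upperLyapunov]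
  generalize Real.exp (-(b - a)) = E at hE hE1
  generalize (γ a).1 - 1 / 2 = u
  generalize (γ a).2 + 4 / 5 * (γ a).1 + ε - 1 / 3 = v
  have : u * E ^ 2 - C * (v ^ 4 * E ^ 6) / (u * E ^ 2) ^ 2 = (u - C * v ^ 4 / u ^ 2) * E ^ 2 := by
    -- The quotient v⁴/u³ is invariant, so the expression scales like u. The identity survives at u
    -- = 0 because division by zero is zero.
    rcases eq_or_ne u 0 with rfl | hu
    · simp
    · field_simp
  rw [this, abs_mul, abs_of_pos (by positivity : 0 < E ^ 2)]
  refine mul_le_mul_of_nonneg_left ?_ (abs_nonneg _)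
  nlinarith

theorem IsFilippovSolution.lowerLyapunov_le {ε : ℝ} {γ : ℝ → ℝ × ℝ} (C κ : ℝ)
    (hγ : IsFilippovSolution (welanderField ε) Prod.snd (Ici 0) γ) {a b : ℝ} (ha : 0 ≤ a)
    (hab : a ≤ b) (h : ∀ t ∈ Ioo a b, (γ t).2 < 0) :
    lowerLyapunov ε C κ (γ b) ≤ lowerLyapunov ε C κ (γ a) * Real.exp (-(b - a)) := by
  obtain ⟨h1, h2⟩ := hγ.flow_of_neg ha hab h
  have e2 : Real.exp (-(1 / 2) * (b - a)) ^ 2 = Real.exp (-(b - a)) := by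
    rw [← Real.exp_nat_mul]; congr 1; push_cast; ring
  rw [lowerLyapunov, h1, h2, mul_pow, e2, lowerLyapunov, neg_one_mul,
    ← abs_of_pos (Real.exp_pos (-(b - a))), ← abs_mul, abs_of_pos (Real.exp_pos (-(b - a)))]
  apply le_of_eq
  congr 1
  ring

namespace IsTwoArcCycle

variable {ε ξ σ X Y q r : ℝ}

theorem upperLyapunov_upperArc (h : IsTwoArcCycle ε ξ σ X Y q r) {θ : ℝ} (hθ : 0 < θ) :
    upperLyapunov ε (ξ ^ 3 / σ ^ 4) (upperArc ε ξ σ θ) = 0 := by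
  have hθ' := hθ.ne'
  have h1 := h.ξ_pos
  have h2 := h.σ_pos
  simp only [upperLyapunov, upperArc, abs_eq_zero]
  have e1 : 1 / 2 + ξ * θ ^ 4 - 1 / 2 = ξ * θ ^ 4 := by ring
  have e2 : 1 / 3 + σ * θ ^ 3 - 4 / 5 * (1 / 2 + ξ * θ ^ 4) - ε + 4 / 5 * (1 / 2 + ξ * θ ^ 4) + ε
    - 1 / 3 = σ * θ ^ 3 := by ring
  rw [e1, e2]
  field_simp
  ring

theorem lowerLyapunov_lowerArc (h : IsTwoArcCycle ε ξ σ X Y q r) (κ θ : ℝ) :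
    lowerLyapunov ε (X / Y ^ 2) κ (lowerArc ε X Y θ) = 0 := by
  have h2 := h.Y_pos
  simp only [lowerLyapunov, lowerArc, abs_eq_zero]
  field_simp
  ring

/-- With u, v > 0 the zero set is a single orbit of the field k = 1: θ is recovered as the cube root
of v/σ, and then u = ξθ⁴. The condition y ≥ 0 cuts out the arc. -/
theorem upperLyapunov_eq_zero_iff (h : IsTwoArcCycle ε ξ σ X Y q r) {p : ℝ × ℝ} (h1 : 1 / 2 < p.1)
    (h2 : 1 / 3 < p.2 + 4 / 5 * p.1 + ε) (h0 : 0 ≤ p.2) :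
    upperLyapunov ε (ξ ^ 3 / σ ^ 4) p = 0 ↔ p ∈ twoArcCycle ε ξ σ X Y q r := by
  have hξ := h.ξ_pos
  have hσ := h.σ_pos
  constructor
  · intro hp
    rw [upperLyapunov, abs_eq_zero] at hp
    obtain ⟨u, hu⟩ : ∃ u, u = p.1 - 1 / 2 := ⟨_, rfl⟩
    obtain ⟨v, hv⟩ : ∃ v, v = p.2 + 4 / 5 * p.1 + ε - 1 / 3 := ⟨_, rfl⟩
    rw [← hu, ← hv] at hp
    have hu0 : 0 < u := by rw [hu]; linarith
    have hv0 : 0 < v := by rw [hv]; linarith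
    obtain ⟨θ, hθ, hθv⟩ : ∃ θ > 0, θ ^ 3 = v / σ :=
      ⟨(v / σ) ^ ((3 : ℕ) : ℝ)⁻¹, by positivity,
        Real.rpow_inv_natCast_pow (by positivity) (by norm_num)⟩
    have hvθ : v = σ * θ ^ 3 := by rw [hθv]; field_simp
    have huθ : u = ξ * θ ^ 4 := by
      have h3 : u ^ 3 = (ξ * θ ^ 4) ^ 3 := by
        rw [hvθ] at hp
        field_simp at hp
        have : u ^ 3 - ξ ^ 3 * (θ ^ 3) ^ 4 = 0 := by linarith
        linear_combination this
      exact (pow_left_inj₀ hu0.le (by positivity) (by norm_num)).1 h3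
    have hpe : upperArc ε ξ σ θ = p := by
      ext
      · simp only [upperArc]; linarith
      · simp only [upperArc]; linarith
    rw [← hpe] at h0 ⊢
    exact Or.inl ⟨θ, (h.upperArc_snd_nonneg_iff hθ).1 h0, rfl⟩
  · intro hp
    obtain ⟨θ, hθ, rfl⟩ := h.mem_upperArc hp h0
    exact h.upperLyapunov_upperArc (h.q_pos.trans_le hθ.1)

theorem lowerLyapunov_eq_zero_iff (h : IsTwoArcCycle ε ξ σ X Y q r) {p : ℝ × ℝ} {κ : ℝ} (hκ : 0 < κ)
    (h0 : p.2 ≤ 0) :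
    lowerLyapunov ε (X / Y ^ 2) κ p = 0 ↔ p ∈ twoArcCycle ε ξ σ X Y q r := by
  have hY := h.Y_pos
  constructor
  · intro hp
    rw [lowerLyapunov, abs_eq_zero, mul_eq_zero, or_iff_right hκ.ne'] at hp
    have hpe : lowerArc ε X Y ((1 - (p.2 + 4 / 5 * p.1 + ε)) / Y) = p := by
      have e1 : 1 - X * ((1 - (p.2 + 4 / 5 * p.1 + ε)) / Y) ^ 2 = p.1 := by
        rw [div_pow]
        linear_combination hp
      ext
      · exact e1
      · simp only [lowerArc]
        rw [e1]
        field_simp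
        ring
    rw [← hpe] at h0 ⊢
    exact Or.inr ⟨_, h.lowerArc_snd_nonpos_iff.1 h0, rfl⟩
  · intro hp
    obtain ⟨θ, hθ, rfl⟩ := h.mem_lowerArc hp h0
    exact h.lowerLyapunov_lowerArc κ θ

/-- On the arc Cv⁴/u³ = 1 with C = ξ³/σ⁴, so differentiating u - Cv⁴/u² along y = 0, where dv/dx =
4/5, gives 3 - (16/5)(u/v), and u/v = ξθ/σ. -/
theorem hasDerivAt_upper (h : IsTwoArcCycle ε ξ σ X Y q r) {θ : ℝ} (hθ : 0 < θ)
    (h0 : (upperArc ε ξ σ θ).2 = 0) :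
    HasDerivAt (fun x => x - 1 / 2 - ξ ^ 3 / σ ^ 4 * (0 + 4 / 5 * x + ε - 1 / 3) ^ 4
      / (x - 1 / 2) ^ 2) (3 - 16 / 5 * (ξ * θ / σ)) (1 / 2 + ξ * θ ^ 4) := by
  have hξ := h.ξ_pos
  have hσ := h.σ_pos
  simp only [upperArc] at h0
  have e1 : 1 / 2 + ξ * θ ^ 4 - 1 / 2 = ξ * θ ^ 4 := by ring
  have e2 : 0 + 4 / 5 * (1 / 2 + ξ * θ ^ 4) + ε - 1 / 3 = σ * θ ^ 3 := by linarith
  have d1 : HasDerivAt (fun x : ℝ => x - 1 / 2) 1 (1 / 2 + ξ * θ ^ 4) :=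
    (hasDerivAt_id _).sub_const _
  have d2 : HasDerivAt (fun x : ℝ => 0 + 4 / 5 * x + ε - 1 / 3) (4 / 5) (1 / 2 + ξ * θ ^ 4) := by
    simpa using ((((hasDerivAt_id (1 / 2 + ξ * θ ^ 4)).const_mul (4 / 5)).const_add 0).add_const
      ε).sub_const (1 / 3)
  refine (d1.sub (((d2.pow 4).const_mul (ξ ^ 3 / σ ^ 4)).div (d1.pow 2) ?_)).congr_deriv ?_
  · simp only [Pi.pow_apply, e1]; positivity
  · simp only [Pi.pow_apply, e1, e2]
    field_simp
    ring

theorem hasDerivAt_lower (h : IsTwoArcCycle ε ξ σ X Y q r) (κ : ℝ) {θ : ℝ}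
    (h0 : (lowerArc ε X Y θ).2 = 0) :
    HasDerivAt (fun x => κ * (1 - x - X / Y ^ 2 * (1 - (0 + 4 / 5 * x + ε)) ^ 2))
      (κ * (-1 + 8 / 5 * (X * θ / Y))) (1 - X * θ ^ 2) := by
  have hY := h.Y_pos
  simp only [lowerArc] at h0
  have e2 : 1 - (0 + 4 / 5 * (1 - X * θ ^ 2) + ε) = Y * θ := by linarith
  have d1 : HasDerivAt (fun x : ℝ => 1 - x) (-1) (1 - X * θ ^ 2) :=
    (hasDerivAt_id _).const_sub _
  have d2 : HasDerivAt (fun x : ℝ => 1 - (0 + 4 / 5 * x + ε)) (-(4 / 5)) (1 - X * θ ^ 2) := by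
    simpa using ((((hasDerivAt_id (1 - X * θ ^ 2)).const_mul (4 / 5)).const_add 0).add_const
      ε).const_sub 1
  refine ((d1.sub ((d2.pow 2).const_mul (X / Y ^ 2))).const_mul κ).congr_deriv ?_
  simp only [e2]
  field_simp
  ring

/-- A weight that makes both passages between the two Lyapunov functions strictly decreasing. -/
theorem exists_weight (h : IsTwoArcCycle ε ξ σ X Y q r) : ∃ κ > 0,
    |3 - 16 / 5 * (ξ * 1 / σ)| < |κ * (-1 + 8 / 5 * (X * r / Y))| ∧
    |κ * (-1 + 8 / 5 * (X * 1 / Y))| < |3 - 16 / 5 * (ξ * q / σ)| := by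
  have hξ := h.ξ_pos
  have hσ := h.σ_pos
  have hq := h.q_pos
  have hr := h.r_pos
  have hX := h.X_pos
  have hY := h.Y_pos
  have hm : 0 < (1 - r) / (1 + r) := div_pos (by linarith [h.r_lt]) (by linarith)
  -- The lower slopes at the two crossings are opposite, so one constant c = κ(1 - r)/(1 + r) has to
  -- fit strictly between the moduli of the two upper slopes.
  have e1 : -1 + 8 / 5 * (X * r / Y) = -((1 - r) / (1 + r)) := by
    rw [h.Y_eq]; field_simp; ring
  have e2 : -1 + 8 / 5 * (X * 1 / Y) = (1 - r) / (1 + r) := by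
    rw [h.Y_eq]; field_simp; ring
  have hz : 3 - 16 / 5 * (ξ * 1 / σ) < 0 := by
    have := h.right_tangency_upper
    have := h.right_upper
    rw [sub_neg, mul_one, ← mul_div_assoc, lt_div_iff₀ hσ]
    linarith
  have hzq : |3 - 16 / 5 * (ξ * 1 / σ)| < 3 - 16 / 5 * (ξ * q / σ) := by
    rw [abs_of_neg hz]
    -- This is the stability condition: it says that the two upper slopes have positive sum.
    have hlt : 16 * ξ * (1 + q) < 30 * σ := by
      have hD : 0 < 1 + q + q ^ 2 := by positivity
      have h1 : 0 < (30 * σ - 16 * ξ * (1 + q)) * (1 + q + q ^ 2) := by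
        have : (30 * σ - 16 * ξ * (1 + q)) * (1 + q + q ^ 2) = 8 * ξ * (1 + q) * (1 - q) ^ 2 := by
          linear_combination 30 * h.σ_mul
        rw [this]
        have : 0 < 1 - q := by linarith [h.q_lt]
        positivity
      linarith [(mul_pos_iff_of_pos_right hD).1 h1]
    have h2 : ξ * 1 / σ + ξ * q / σ < 30 / 16 := by
      rw [← add_div, div_lt_iff₀ hσ]
      linarith
    linarith
  obtain ⟨c, hc1, hc2⟩ := exists_between hzq
  have hc0 : 0 < c := (abs_nonneg _).trans_lt hc1
  refine ⟨c / ((1 - r) / (1 + r)), by positivity, ?_, ?_⟩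
  · rw [e1, mul_neg, abs_neg, div_mul_cancel₀ _ hm.ne', abs_of_pos hc0]
    exact hc1
  · rw [e2, div_mul_cancel₀ _ hm.ne', abs_of_pos hc0]
    exact hc2.trans_le (le_abs_self _)

theorem bounds_of_mem (h : IsTwoArcCycle ε ξ σ X Y q r) {p : ℝ × ℝ}
    (hp : p ∈ twoArcCycle ε ξ σ X Y q r) : 1 / 2 < p.1 ∧ 1 / 3 < p.2 + 4 / 5 * p.1 + ε := by
  have hξ := h.ξ_pos
  have hσ := h.σ_pos
  have hq := h.q_pos
  have hX := h.X_pos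
  have hY := h.Y_pos
  rcases hp with ⟨θ, hθ, rfl⟩ | ⟨θ, hθ, rfl⟩
  · have hθ0 : 0 < θ := hq.trans_le hθ.1
    have h1 : 0 < ξ * θ ^ 4 := by positivity
    have h2 : 0 < σ * θ ^ 3 := by positivity
    simp only [upperArc]
    constructor <;> linarith
  · have hθ0 : 0 < θ := h.r_pos.trans_le hθ.1
    have h1 : 0 < ξ * q ^ 4 := by positivity
    have h2 : 0 < σ * q ^ 3 := by positivity
    have h3 : X * θ ^ 2 ≤ X := mul_le_of_le_one_right hX.le (by nlinarith [hθ.2])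
    have h4 : Y * θ ≤ Y := mul_le_of_le_one_right hY.le hθ.2
    have := h.left_fst
    have := h.left_upper
    have := h.left_lower
    simp only [lowerArc]
    constructor <;> linarith

theorem isAsymptoticallyStable (h : IsTwoArcCycle ε ξ σ X Y q r) :
    IsAsymptoticallyStable (welanderField ε) Prod.snd (twoArcCycle ε ξ σ X Y q r) := by
  obtain ⟨κ, hκ, hκr, hκl⟩ := h.exists_weight
  -- The passage condition is vacuous off y = 0, so only the two crossing points need the slope
  -- comparison to lie in the interior of U.
  let U : Set (ℝ × ℝ) := {p | (1 / 2 < p.1 ∧ 1 / 3 < p.2 + 4 / 5 * p.1 + ε) ∧ (p.2 = 0 →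
    (3 / 4 + 15 / 4 * ε < p.1 ∧ 3 / 4 + 5 / 4 * ε < p.1 ∧
      upperLyapunov ε (ξ ^ 3 / σ ^ 4) p ≤ lowerLyapunov ε (X / Y ^ 2) κ p) ∨
    (p.1 < 3 / 4 + 15 / 4 * ε ∧ p.1 < 3 / 4 + 5 / 4 * ε ∧
      lowerLyapunov ε (X / Y ^ 2) κ p ≤ upperLyapunov ε (ξ ^ 3 / σ ^ 4) p))}
  have hpos : ∀ p ∈ interior U, p ∈ U := fun p hp => interior_subset hp
  refine isAsymptoticallyStable_of_splitFun (W₁ := upperLyapunov ε (ξ ^ 3 / σ ^ 4))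
    (W₀ := lowerLyapunov ε (X / Y ^ 2) κ) (U := interior U) (isCompact ε ξ σ X Y q r) isOpen_interior ?_
    ⟨_, Or.inl ⟨1, ⟨h.q_lt.le, le_rfl⟩, rfl⟩⟩ ?_ ?_ (fun p => abs_nonneg _) (fun p => abs_nonneg _)
    (fun p hp h0 => h.upperLyapunov_eq_zero_iff (hpos p hp).1.1 (hpos p hp).1.2 h0)
    (fun p hp h0 => h.lowerLyapunov_eq_zero_iff hκ h0)
    (fun γ hγ a b => hγ.upperLyapunov_le _) (fun γ hγ a b => hγ.lowerLyapunov_le _ _)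
    (fun p hp => (hpos p hp).2)
  · intro p hp
    rw [mem_interior_iff_mem_nhds]
    obtain ⟨hp1, hp2⟩ := h.bounds_of_mem hp
    have ev1 : ∀ᶠ p' : ℝ × ℝ in 𝓝 p, 1 / 2 < p'.1 :=
      continuousAt_const.eventually_lt (by fun_prop) hp1
    have ev2 : ∀ᶠ p' : ℝ × ℝ in 𝓝 p, 1 / 3 < p'.2 + 4 / 5 * p'.1 + ε :=
      continuousAt_const.eventually_lt (by fun_prop) hp2
    refine (ev1.and ev2).and ?_
    by_cases h0 : p.2 = 0
    · rcases h.snd_eq_zero hp h0 with rfl | rfl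
      · have hd1 := h.hasDerivAt_upper one_pos (by rw [h.upperArc_one])
        have hd0 := h.hasDerivAt_lower κ (θ := r) (by rw [h.lowerArc_r])
        have z1 := h.upperLyapunov_upperArc one_pos
        have z0 := h.lowerLyapunov_lowerArc κ r
        rw [h.upperArc_one, upperLyapunov, abs_eq_zero] at z1
        rw [h.lowerArc_r, lowerLyapunov, abs_eq_zero] at z0
        rw [one_pow, mul_one ξ] at hd1
        rw [← h.right_fst] at hd0
        have ev := eventually_abs_le_abs_of_hasDerivAt hd1 hd0 z1 z0 (by simpa using hκr)
        have ev3 : ∀ᶠ x in 𝓝 (1 / 2 + ξ), 3 / 4 + 15 / 4 * ε < x :=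
          lt_mem_nhds h.right_tangency_upper
        have ev4 : ∀ᶠ x in 𝓝 (1 / 2 + ξ), 3 / 4 + 5 / 4 * ε < x :=
          lt_mem_nhds h.right_tangency_lower
        have hf : Tendsto (Prod.fst : ℝ × ℝ → ℝ) (𝓝 (1 / 2 + ξ, 0)) (𝓝 (1 / 2 + ξ)) :=
          continuous_fst.tendsto _
        filter_upwards [hf.eventually ev, hf.eventually ev3, hf.eventually ev4]
          with p' e1 e2 e3 e0
        refine Or.inl ⟨e2, e3, ?_⟩
        simpa only [upperLyapunov, lowerLyapunov, e0] using e1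
      · have hd1 := h.hasDerivAt_upper h.q_pos (by rw [h.upperArc_q])
        have hd0 := h.hasDerivAt_lower κ (θ := 1) (by rw [h.lowerArc_one])
        have z1 := h.upperLyapunov_upperArc h.q_pos
        have z0 := h.lowerLyapunov_lowerArc κ 1
        rw [h.upperArc_q, upperLyapunov, abs_eq_zero] at z1
        rw [h.lowerArc_one, lowerLyapunov, abs_eq_zero] at z0
        rw [h.left_fst] at hd1
        rw [one_pow, mul_one X] at hd0
        have ev := eventually_abs_le_abs_of_hasDerivAt hd0 hd1 z0 z1 (by simpa using hκl)
        have ev3 : ∀ᶠ x in 𝓝 (1 - X), x < 3 / 4 + 15 / 4 * ε :=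
          gt_mem_nhds h.left_tangency_upper
        have ev4 : ∀ᶠ x in 𝓝 (1 - X), x < 3 / 4 + 5 / 4 * ε :=
          gt_mem_nhds h.left_tangency_lower
        have hf : Tendsto (Prod.fst : ℝ × ℝ → ℝ) (𝓝 (1 - X, 0)) (𝓝 (1 - X)) :=
          continuous_fst.tendsto _
        filter_upwards [hf.eventually ev, hf.eventually ev3, hf.eventually ev4]
          with p' e1 e2 e3 e0
        refine Or.inr ⟨e2, e3, ?_⟩
        simpa only [upperLyapunov, lowerLyapunov, e0] using e1
    · filter_upwards [(continuous_snd.continuousAt (x := p)).eventually_ne h0] with p' h1 h2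
      exact absurd h2 h1
  · intro p hp
    have h1 : p.1 - 1 / 2 ≠ 0 := (sub_pos.2 (hpos p hp).1.1).ne'
    unfold upperLyapunov
    refine ContinuousAt.continuousWithinAt (ContinuousAt.abs ?_)
    refine ContinuousAt.sub (by fun_prop) (ContinuousAt.div (by fun_prop) (by fun_prop) ?_)
    exact pow_ne_zero 2 h1
  · unfold lowerLyapunov
    fun_prop

end IsTwoArcCycle

/-! ### Realization of a two-arc cycle as a periodic solution, and its size. -/

namespace IsTwoArcCycle

variable {ε ξ σ X Y q r : ℝ}

theorem image_exp_Icc {θ : ℝ} (hθ : 0 < θ) (a : ℝ) :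
    (fun t => Real.exp (-(1 / 2) * (t - a))) '' Icc a (a - 2 * Real.log θ) = Icc θ 1 := by
  ext x
  constructor
  · rintro ⟨t, ht, rfl⟩
    refine ⟨?_, Real.exp_le_one_iff.2 (by linarith [ht.1])⟩
    rw [← Real.log_le_iff_le_exp hθ]
    linarith [ht.2]
  · rintro hx
    have hx0 : 0 < x := hθ.trans_le hx.1
    have h1 := Real.log_le_log hθ hx.1
    have h2 := Real.log_nonpos hx0.le hx.2
    refine ⟨a - 2 * Real.log x, ⟨by linarith, by linarith⟩, ?_⟩
    simp only
    rw [show -(1 / 2) * (a - 2 * Real.log x - a) = Real.log x by ring, Real.exp_log hx0]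

theorem hasDerivAt_exp (a t : ℝ) : HasDerivAt (fun t => Real.exp (-(1 / 2) * (t - a)))
    (-(1 / 2) * Real.exp (-(1 / 2) * (t - a))) t := by
  have := (((hasDerivAt_id t).sub_const a).const_mul (-(1 / 2))).exp
  simpa [mul_comm] using this

theorem hasDerivAt_upperArc_exp (ε ξ σ a t : ℝ) :
    HasDerivAt (fun t => upperArc ε ξ σ (Real.exp (-(1 / 2) * (t - a))))
      (welanderField ε (upperArc ε ξ σ (Real.exp (-(1 / 2) * (t - a)))) 1) t := by
  have h := hasDerivAt_exp a t
  have h1 := ((h.pow 4).const_mul ξ).const_add (1 / 2)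
  have h2 := (((h.pow 3).const_mul σ).const_add (1 / 3)).sub (h1.const_mul (4 / 5)) |>.sub_const ε
  refine (h1.prodMk h2).congr_deriv ?_
  rw [upperArc, welanderField, welander_eq]
  simp only [Prod.mk.injEq]
  constructor
  · ring
  · ring

theorem hasDerivAt_lowerArc_exp (ε X Y a t : ℝ) :
    HasDerivAt (fun t => lowerArc ε X Y (Real.exp (-(1 / 2) * (t - a))))
      (welanderField ε (lowerArc ε X Y (Real.exp (-(1 / 2) * (t - a)))) 0) t := by
  have h := hasDerivAt_exp a t
  have h1 := ((h.pow 2).const_mul X).const_sub 1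
  have h2 := ((h.const_mul Y).const_sub 1).sub (h1.const_mul (4 / 5)) |>.sub_const ε
  refine (h1.prodMk h2).congr_deriv ?_
  rw [lowerArc, welanderField, welander_eq]
  simp only [Prod.mk.injEq]
  constructor
  · ring
  · ring

theorem exists_lipschitzOnWith_of_contDiff {g : ℝ → ℝ × ℝ} (hg : ContDiff ℝ 1 g) (a b : ℝ) :
    ∃ K, LipschitzOnWith K g (Icc a b) :=
  hg.contDiffOn.exists_lipschitzOnWith (by decide) (convex_Icc _ _) isCompact_Icc

theorem isPeriodicOrbit (h : IsTwoArcCycle ε ξ σ X Y q r) :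
    IsPeriodicOrbit (welanderField ε) Prod.snd (twoArcCycle ε ξ σ X Y q r) := by
  -- Since θ = exp(-t/2), the upper arc lasts -2 log q and the lower arc -2 log r.
  obtain ⟨a, ha⟩ : ∃ a, a = 0 - 2 * Real.log q := ⟨_, rfl⟩
  obtain ⟨T, hT⟩ : ∃ T, T = a - 2 * Real.log r := ⟨_, rfl⟩
  have ha0 : 0 < a := by linarith [Real.log_neg h.q_pos h.q_lt]
  have haT : a < T := by linarith [Real.log_neg h.r_pos h.r_lt]
  set u : ℝ → ℝ × ℝ := fun t => upperArc ε ξ σ (Real.exp (-(1 / 2) * (t - 0))) with hu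
  set l : ℝ → ℝ × ℝ := fun t => lowerArc ε X Y (Real.exp (-(1 / 2) * (t - a))) with hl
  have hua : u a = l a := by
    have e1 : Real.exp (-(1 / 2) * (a - 0)) = q := by
      rw [ha, show -(1 / 2) * (0 - 2 * Real.log q - 0) = Real.log q by ring, Real.exp_log h.q_pos]
    simp only [hu, hl]
    rw [e1, sub_self, mul_zero, Real.exp_zero, h.upperArc_q, h.lowerArc_one]
  have hlT : l T = u 0 := by
    have e1 : Real.exp (-(1 / 2) * (T - a)) = r := by
      rw [hT, show -(1 / 2) * (a - 2 * Real.log r - a) = Real.log r by ring, Real.exp_log h.r_pos]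
    simp only [hu, hl]
    rw [e1, sub_self, mul_zero, Real.exp_zero, h.upperArc_one, h.lowerArc_r]
  set g : ℝ → ℝ × ℝ := fun t => if t ≤ a then u t else l t with hg
  have hgu : EqOn g u (Icc 0 a) := fun t ht => if_pos ht.2
  have hgl : EqOn g l (Icc a T) := fun t ht => by
    rcases ht.1.eq_or_lt with rfl | hlt
    · simp only [hg, le_refl, if_true, hua]
    · exact if_neg hlt.not_ge
  obtain ⟨K₁, hK₁⟩ := exists_lipschitzOnWith_of_contDiff (g := u)
    (by unfold u upperArc; fun_prop) 0 a
  obtain ⟨K₂, hK₂⟩ := exists_lipschitzOnWith_of_contDiff (g := l)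
    (by unfold l lowerArc; fun_prop) a T
  have hLip : LipschitzOnWith (max K₁ K₂) g (Icc 0 T) := by
    refine LipschitzOnWith.Icc_union (b := a) ?_ ?_
    · exact fun s hs t ht => by
        rw [hgu hs, hgu ht]; exact (hK₁.weaken (le_max_left _ _)) hs ht
    · exact fun s hs t ht => by
        rw [hgl hs, hgl ht]; exact (hK₂.weaken (le_max_right _ _)) hs ht
  have himg : g '' Icc 0 T = twoArcCycle ε ξ σ X Y q r := by
    rw [← Icc_union_Icc_eq_Icc ha0.le haT.le, image_union, hgu.image_eq, hgl.image_eq, twoArcCycle,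
      ← image_exp_Icc h.q_pos 0, ← image_exp_Icc h.r_pos a, ← ha, ← hT, image_image, image_image]
  obtain ⟨γ, hγ, hper, hrange⟩ := exists_periodic_filippovSolution (f := welanderField ε)
    (h := Prod.snd) (ha0.trans haT) hLip
    (by rw [hgu ⟨le_rfl, ha0.le⟩, hgl ⟨haT.le, le_rfl⟩, hlT]) (countable_singleton a) (by
      intro t ht hta
      rcases lt_or_gt_of_ne (show t ≠ a from hta) with hlt | hgt
      · have hge : g =ᶠ[𝓝 t] u := by
          filter_upwards [gt_mem_nhds hlt] with s hs using if_pos hs.le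
        refine ⟨_, ⟨1, ⟨by norm_num, fun _ => rfl, fun hneg => ?_⟩, rfl⟩, ?_⟩
        · rw [hge.eq_of_nhds] at hneg
          have hmem : Real.exp (-(1 / 2) * (t - 0)) ∈ Icc q 1 := by
            rw [← image_exp_Icc h.q_pos 0, ← ha]
            exact ⟨t, ⟨ht.1.le, hlt.le⟩, rfl⟩
          exact absurd ((h.upperArc_snd_nonneg_iff (Real.exp_pos _)).2 hmem) (not_le.2 hneg)
        · rw [hge.eq_of_nhds]
          exact (hasDerivAt_upperArc_exp ε ξ σ 0 t).congr_of_eventuallyEq hge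
      · have hge : g =ᶠ[𝓝 t] l := by
          filter_upwards [lt_mem_nhds hgt] with s hs using if_neg hs.not_ge
        refine ⟨_, ⟨0, ⟨by norm_num, fun hpos => ?_, fun _ => rfl⟩, rfl⟩, ?_⟩
        · rw [hge.eq_of_nhds] at hpos
          have hmem : Real.exp (-(1 / 2) * (t - a)) ∈ Icc r 1 := by
            rw [← image_exp_Icc h.r_pos a, ← hT]
            exact ⟨t, ⟨hgt.le, ht.2.le⟩, rfl⟩
          exact absurd (h.lowerArc_snd_nonpos_iff.2 hmem) (not_le.2 hpos)
        · rw [hge.eq_of_nhds]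
          exact (hasDerivAt_lowerArc_exp ε X Y a t).congr_of_eventuallyEq hge)
  refine ⟨γ, hγ, ⟨T, ha0.trans haT, hper⟩, ?_, hrange.trans himg⟩
  have m1 : upperArc ε ξ σ 1 ∈ range γ := by
    rw [hrange, himg]; exact Or.inl ⟨1, ⟨h.q_lt.le, le_rfl⟩, rfl⟩
  have m2 : upperArc ε ξ σ q ∈ range γ := by
    rw [hrange, himg]; exact Or.inl ⟨q, ⟨le_rfl, h.q_lt.le⟩, rfl⟩
  obtain ⟨s, hs⟩ := m1
  obtain ⟨t, ht⟩ := m2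
  refine ⟨s, t, fun hst => ?_⟩
  rw [hs, ht, h.upperArc_one, h.upperArc_q] at hst
  have h1 := congrArg Prod.fst hst
  simp only at h1
  linarith [h.right_tangency_lower, h.left_tangency_lower]

end IsTwoArcCycle

theorem IsTwoArcCycle.subset_ball {ε ξ σ X Y q r δ : ℝ} (h : IsTwoArcCycle ε ξ σ X Y q r)
    (h1 : |ξ - 1 / 4| < δ / 3) (h2 : |ξ * q ^ 4 - 1 / 4| < δ / 3) (h3 : |σ - 4 / 15| < δ / 3)
    (h4 : |σ * q ^ 3 - 4 / 15| < δ / 3) (h5 : |ε| < δ / 3) :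
    twoArcCycle ε ξ σ X Y q r ⊆ Metric.ball (3 / 4, 0) δ := by
  have hX := h.X_pos
  have hY := h.Y_pos
  have hξ := h.ξ_pos
  have hσ := h.σ_pos
  have hq := h.q_pos
  have hr := h.r_pos
  rw [abs_lt] at h1 h2 h3 h4 h5
  -- T and S are monotone along each arc, so the cycle lies in the rectangle spanned by its
  -- crossings. Each of S, 4T/5 and ε contributes less than δ/3 to |y|.
  have key : ∀ x S : ℝ, 1 / 2 + ξ * q ^ 4 ≤ x → x ≤ 1 / 2 + ξ → 1 / 3 + σ * q ^ 3 ≤ S →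
      S ≤ 1 / 3 + σ → (x, S - 4 / 5 * x - ε) ∈ Metric.ball ((3 / 4 : ℝ), (0 : ℝ)) δ := by
    intro x S a1 a2 a3 a4
    rw [Metric.mem_ball, Prod.dist_eq, max_lt_iff, Real.dist_eq, Real.dist_eq, abs_lt, abs_lt]
    refine ⟨⟨?_, ?_⟩, ⟨?_, ?_⟩⟩ <;> linarith
  rintro p (⟨θ, hθ, rfl⟩ | ⟨θ, hθ, rfl⟩)
  · have hθ0 : 0 < θ := hq.trans_le hθ.1
    refine key _ _ ?_ ?_ ?_ ?_
    · have := mul_le_mul_of_nonneg_left (pow_le_pow_left₀ hq.le hθ.1 4) hξ.le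
      linarith
    · have := mul_le_of_le_one_right hξ.le (pow_le_one₀ hθ0.le hθ.2 : θ ^ 4 ≤ 1)
      linarith
    · have := mul_le_mul_of_nonneg_left (pow_le_pow_left₀ hq.le hθ.1 3) hσ.le
      linarith
    · have := mul_le_of_le_one_right hσ.le (pow_le_one₀ hθ0.le hθ.2 : θ ^ 3 ≤ 1)
      linarith
  · have hθ0 : 0 < θ := hr.trans_le hθ.1
    have e1 := h.left_fst
    have e2 := h.right_fst
    have e3 := h.left_upper
    have e4 := h.left_lower
    have e5 := h.right_upper
    have e6 := h.right_lower
    refine key _ _ ?_ ?_ ?_ ?_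
    · have := mul_le_of_le_one_right hX.le (pow_le_one₀ hθ0.le hθ.2 : θ ^ 2 ≤ 1)
      linarith
    · have := mul_le_mul_of_nonneg_left (pow_le_pow_left₀ hr.le hθ.1 2) hX.le
      linarith
    · have := mul_le_of_le_one_right hY.le hθ.2
      linarith
    · have := mul_le_mul_of_nonneg_left hθ.1 hY.le
      linarith

/-! ### The family of two-arc cycles, parametrized by the contraction factor `q` of the upper arc

The factor `r` of the lower arc is `1 - (1 - q) w`, where `w` solves
`(1 - q) a w² - m w + D E = 0`. -/

namespace CycleFamily

/-- `1 + q + q²`. -/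
def D (q : ℝ) : ℝ := 1 + q + q ^ 2

/-- `1 + q + q² + q³`. -/
def E (q : ℝ) : ℝ := 1 + q + q ^ 2 + q ^ 3

/-- The leading coefficient, up to the factor `1 - q`. -/
def a (q : ℝ) : ℝ := q ^ 3 * (5 * D q * q - 3 * E q)

/-- The negative of the linear coefficient. -/
def m (q : ℝ) : ℝ := 2 * a q + 3 * E q * (1 - q ^ 3)

/-- The discriminant. -/
def disc (q : ℝ) : ℝ := m q ^ 2 - 4 * a q * (1 - q) * D q * E q

/-- The smaller root of the quadratic equation. -/
noncomputable def w (q : ℝ) : ℝ := 2 * D q * E q / (m q + √(disc q))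

/-- The contraction factor of the lower arc. -/
noncomputable def r (q : ℝ) : ℝ := 1 - (1 - q) * w q

/-- The value of `S - 1/3` at the start of the upper arc. -/
noncomputable def σ (q : ℝ) : ℝ := 2 / 3 * w q / (D q + q ^ 3 * w q)

/-- The value of `T - 1/2` at the start of the upper arc. -/
noncomputable def ξ (q : ℝ) : ℝ := 5 / 4 * (D q / E q) * σ q

/-- The parameter for which the cycle exists. -/
noncomputable def ε (q : ℝ) : ℝ := σ q * q ^ 3 / E q - 1 / 15

theorem continuous_D : Continuous D := by unfold D; fun_prop

theorem continuous_E : Continuous E := by unfold E; fun_prop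

theorem continuous_a : Continuous a := by
  have := continuous_D
  have := continuous_E
  unfold a; fun_prop

theorem continuous_m : Continuous m := by
  have := continuous_a
  have := continuous_E
  unfold m; fun_prop

theorem continuous_disc : Continuous disc := by
  have := continuous_D
  have := continuous_a
  have := continuous_m
  have := continuous_E
  unfold disc; fun_prop

theorem D_one : D 1 = 3 := by norm_num [D]

theorem E_one : E 1 = 4 := by norm_num [E]

theorem a_one : a 1 = 3 := by norm_num [a, D, E]

theorem m_one : m 1 = 6 := by norm_num [m, a, D, E]

theorem disc_one : disc 1 = 6 ^ 2 := by norm_num [disc, m, a, D, E]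

theorem w_one : w 1 = 2 := by
  rw [w, D_one, E_one, m_one, disc_one, Real.sqrt_sq (by norm_num)]
  norm_num

theorem r_one : r 1 = 1 := by simp [r]

theorem σ_one : σ 1 = 4 / 15 := by
  rw [σ, w_one, D_one]
  norm_num

theorem ξ_one : ξ 1 = 1 / 4 := by
  rw [ξ, σ_one, D_one, E_one]
  norm_num

theorem ε_one : ε 1 = 0 := by
  rw [ε, σ_one, E_one]
  norm_num

/-- The root is written in rationalized form because the leading coefficient (1 - q)a vanishes at q
= 1, where the equation becomes linear with root 2; this form remains continuous there. -/
theorem continuousAt_w {q : ℝ} (hm : 0 < m q) : ContinuousAt w q := by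
  have h1 : 0 < m q + √(disc q) := by positivity
  exact ContinuousAt.div
    (((continuous_const.mul continuous_D).mul continuous_E).continuousAt)
    ((continuous_m.add continuous_disc.sqrt).continuousAt) h1.ne'

theorem continuousAt_r {q : ℝ} (hm : 0 < m q) : ContinuousAt r q := by
  have := continuousAt_w hm
  unfold r
  fun_prop

theorem continuousAt_σ {q : ℝ} (hm : 0 < m q) (hq : 0 < q) (hw : 0 < w q) : ContinuousAt σ q := by
  have h1 := continuousAt_w hm
  have h2 := continuous_D.continuousAt (x := q)
  have h3 : 0 < D q + q ^ 3 * w q := by unfold D; positivity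
  exact ContinuousAt.div (by fun_prop) (by fun_prop) h3.ne'

theorem continuousAt_ξ {q : ℝ} (hm : 0 < m q) (hq : 0 < q) (hw : 0 < w q) : ContinuousAt ξ q := by
  have h1 := continuousAt_σ hm hq hw
  have h2 : 0 < E q := by unfold E; positivity
  exact (continuousAt_const.mul
    (continuous_D.continuousAt.div continuous_E.continuousAt h2.ne')).mul h1

theorem continuousAt_ε {q : ℝ} (hm : 0 < m q) (hq : 0 < q) (hw : 0 < w q) : ContinuousAt ε q := by
  have h1 := continuousAt_σ hm hq hw
  have h2 : 0 < E q := by unfold E; positivity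
  exact ((h1.mul (by fun_prop)).div continuous_E.continuousAt h2.ne').sub continuousAt_const

theorem w_quadratic {q : ℝ} (hm : 0 < m q) (hd : 0 ≤ disc q) :
    w q * (m q - a q * (1 - q) * w q) = D q * E q := by
  have h1 : 0 < m q + √(disc q) := by positivity
  have h2 : √(disc q) ^ 2 = m q ^ 2 - 4 * a q * (1 - q) * D q * E q := Real.sq_sqrt hd
  rw [w]
  field_simp
  linear_combination -D q * E q * h2

/-- For `q < 1` near `1` these data give a two-arc cycle. -/
theorem isTwoArcCycle {q : ℝ} (hq : 0 < q) (hq1 : q < 1) (hm : 0 < m q) (hd : 0 ≤ disc q)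
    (hw : 0 < w q) (hr : 0 < r q) (hX : 0 < 1 / 2 - ξ q * q ^ 4) (hY : 0 < 2 / 3 - σ q * q ^ 3) :
    IsTwoArcCycle (ε q) (ξ q) (σ q) (1 / 2 - ξ q * q ^ 4) (2 / 3 - σ q * q ^ 3) q (r q) := by
  have hE : 0 < E q := by unfold E; positivity
  have hD : 0 < D q := by unfold D; positivity
  have hDw : 0 < D q + q ^ 3 * w q := by positivity
  have hσ : 0 < σ q := by unfold σ; positivity
  have hσw : σ q * (D q + q ^ 3 * w q) = 2 / 3 * w q := by
    rw [σ, div_mul_cancel₀ _ hDw.ne']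
  have hξE : ξ q * E q = 5 / 4 * D q * σ q := by
    rw [ξ]; field_simp
  have hεE : (ε q + 1 / 15) * E q = σ q * q ^ 3 := by
    rw [ε]; field_simp; ring
  have hright : 1 / 3 + σ q = 4 / 5 * (1 / 2 + ξ q) + ε q := by
    refine mul_right_cancel₀ hE.ne' ?_
    have : D q = E q - q ^ 3 := by unfold D E; ring
    linear_combination -4 / 5 * hξE - hεE - σ q * this
  have hleft : 1 / 3 + σ q * q ^ 3 = 4 / 5 * (1 / 2 + ξ q * q ^ 4) + ε q := by
    have e : σ q * (1 - q ^ 3) = 4 / 5 * ξ q * (1 - q ^ 4) := by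
      have e1 : 1 - q ^ 3 = (1 - q) * D q := by unfold D; ring
      have e2 : 1 - q ^ 4 = (1 - q) * E q := by unfold E; ring
      rw [e1, e2]
      linear_combination -4 / 5 * (1 - q) * hξE
    linear_combination hright - e
  have hYr : 2 / 3 - σ q = (2 / 3 - σ q * q ^ 3) * r q := by
    have e1 : 1 - q ^ 3 = (1 - q) * D q := by unfold D; ring
    have e2 : r q = 1 - (1 - q) * w q := rfl
    rw [e2]
    linear_combination -(1 - q) * hσw + (-σ q) * e1
  -- With σ determined by the relation for S, this closing relation for T is, after clearing
  -- denominators, (1 - q)w/6 times the quadratic equation; the factor removed is the degenerate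
  -- solution r = 1.
  have hXr : 1 / 2 - ξ q = (1 / 2 - ξ q * q ^ 4) * r q ^ 2 := by
    have hquad := w_quadratic hm hd
    have e2 : r q = 1 - (1 - q) * w q := rfl
    refine mul_right_cancel₀ hE.ne' (mul_right_cancel₀ hDw.ne' ?_)
    have h1 : (1 / 2 - ξ q) * E q * (D q + q ^ 3 * w q) =
        1 / 2 * E q * (D q + q ^ 3 * w q) - 5 / 6 * D q * w q := by
      linear_combination -(D q + q ^ 3 * w q) * hξE - 5 / 4 * D q * hσw
    have h2 : (1 / 2 - ξ q * q ^ 4) * E q * (D q + q ^ 3 * w q) =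
        1 / 2 * E q * (D q + q ^ 3 * w q) - 5 / 6 * D q * w q * q ^ 4 := by
      linear_combination -(D q + q ^ 3 * w q) * q ^ 4 * hξE - 5 / 4 * D q * q ^ 4 * hσw
    rw [h1, mul_right_comm _ (r q ^ 2), mul_right_comm _ (r q ^ 2), h2, e2]
    unfold m a at hquad
    unfold D E at hquad ⊢
    linear_combination -(1 / 6) * (1 - q) * w q * hquad
  exact
    { ξ_pos := by unfold ξ; positivity
      σ_pos := hσ
      X_pos := hX
      Y_pos := hY
      q_pos := hq
      q_lt := hq1
      r_pos := hr
      r_lt := by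
        have : 0 < (1 - q) * w q := mul_pos (by linarith) hw
        have e2 : r q = 1 - (1 - q) * w q := rfl
        linarith
      right_fst := by linarith
      left_fst := by ring
      right_upper := hright
      right_lower := by linarith
      left_upper := hleft
      left_lower := by linarith }

/-- By the quadratic equation, ε < 0 amounts to a·w < N. Both sides equal 6 at q = 1, so continuity
does not decide it. Bounding w by 3 inside the quadratic equation gives an upper bound for a·w, and
its comparison with N leaves 1 - q times the polynomial of `hH`, which equals 372 at q = 1. -/
theorem ε_neg {q : ℝ} (hq : 0 < q) (hq1 : q < 1) (hm : 0 < m q) (hd : 0 ≤ disc q) (hw : 0 < w q)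
    (hw3 : w q ≤ 3) (ha : 0 < a q) (hma : 0 < m q - 3 * a q * (1 - q))
    (hH : 0 < 9 + 36 * q + 90 * q ^ 2 + 129 * q ^ 3 + 106 * q ^ 4 + 19 * q ^ 5 - 137 * q ^ 6
      - 48 * q ^ 7 + 28 * q ^ 8 + 88 * q ^ 9 + 40 * q ^ 10 + 12 * q ^ 11) : ε q < 0 := by
  have hE : 0 < E q := by unfold E; positivity
  have hD : 0 < D q := by unfold D; positivity
  have hs : 0 < 1 - q := by linarith
  have hDw : 0 < D q + q ^ 3 * w q := by positivity
  have hquad := w_quadratic hm hd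
  obtain ⟨N, hN⟩ : ∃ N, N = 3 + 6 * q + 9 * q ^ 2 - 6 * q ^ 3 - 4 * q ^ 4 - 2 * q ^ 5 := ⟨_, rfl⟩
  have hmN : m q - q ^ 3 * (10 - E q) = (1 - q) * N := by
    rw [hN]; unfold m a D E; ring
  have hG : 0 < N * (m q - 3 * a q * (1 - q)) - a q * (D q * E q) := by
    have := mul_pos hs hH
    convert! this using 1
    rw [hN]; unfold m a D E; ring
  have haw : a q * w q < N := by
    have h1 : a q * w q * (m q - 3 * a q * (1 - q)) ≤ a q * (D q * E q) := by
      rw [← hquad, mul_assoc]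
      refine mul_le_mul_of_nonneg_left (mul_le_mul_of_nonneg_left ?_ hw.le) ha.le
      nlinarith [mul_pos ha hs]
    by_contra hc
    have := mul_le_mul_of_nonneg_right (not_lt.1 hc) hma.le
    linarith
  have h2 : q ^ 3 * (10 - E q) < m q - a q * (1 - q) * w q := by
    nlinarith [mul_lt_mul_of_pos_left haw hs]
  have h3 := mul_lt_mul_of_pos_left h2 hw
  rw [hquad] at h3
  rw [ε, sub_neg, div_lt_iff₀ hE, σ, div_mul_eq_mul_div, div_lt_iff₀ hDw]
  linarith

end CycleFamily

open CycleFamily in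
/-- Small cycles exist for all small `ε < 0`. -/
theorem exists_isTwoArcCycle {δ : ℝ} (hδ : 0 < δ) : ∃ ε₀ > 0, ∀ e : ℝ, -ε₀ < e → e < 0 →
    ∃ ξ σ X Y q r : ℝ, IsTwoArcCycle e ξ σ X Y q r ∧
      twoArcCycle e ξ σ X Y q r ⊆ Metric.ball (3 / 4, 0) δ := by
  have hm1 : 0 < m 1 := by rw [m_one]; norm_num
  have hw1 : 0 < w 1 := by rw [w_one]; norm_num
  have cw := continuousAt_w hm1
  have cr := continuousAt_r hm1
  have cσ := continuousAt_σ hm1 one_pos hw1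
  have cξ := continuousAt_ξ hm1 one_pos hw1
  have cε := continuousAt_ε hm1 one_pos hw1
  have hδ3 : 0 < δ / 3 := by positivity
  have ev : ∀ᶠ q in 𝓝 (1 : ℝ), (0 < q ∧ 0 < m q ∧ 0 < disc q ∧ 0 < w q ∧ 0 < r q ∧
      0 < 1 / 2 - ξ q * q ^ 4 ∧ 0 < 2 / 3 - σ q * q ^ 3) ∧
      (|ξ q - 1 / 4| < δ / 3 ∧ |ξ q * q ^ 4 - 1 / 4| < δ / 3 ∧ |σ q - 4 / 15| < δ / 3 ∧
        |σ q * q ^ 3 - 4 / 15| < δ / 3 ∧ |ε q| < δ / 3) ∧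
      (w q < 3 ∧ 0 < a q ∧ 0 < m q - 3 * a q * (1 - q) ∧
        0 < 9 + 36 * q + 90 * q ^ 2 + 129 * q ^ 3 + 106 * q ^ 4 + 19 * q ^ 5 - 137 * q ^ 6
          - 48 * q ^ 7 + 28 * q ^ 8 + 88 * q ^ 9 + 40 * q ^ 10 + 12 * q ^ 11) := by
    have ca := continuous_a
    have cm := continuous_m
    have cd := continuous_disc
    -- Every condition is a strict inequality between functions continuous at 1, hence it is enough
    -- to check it at q = 1.
    refine ((Eventually.and ?_ (Eventually.and ?_ (Eventually.and ?_ (Eventually.and ?_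
      (Eventually.and ?_ (Eventually.and ?_ ?_)))))).and ((Eventually.and ?_ (Eventually.and ?_
      (Eventually.and ?_ (Eventually.and ?_ ?_)))).and (Eventually.and ?_ (Eventually.and ?_
      (Eventually.and ?_ ?_)))))
    all_goals refine ContinuousAt.eventually_lt (by fun_prop) (by fun_prop) ?_
    all_goals norm_num [m_one, w_one, σ_one, ξ_one, ε_one, disc_one, r_one, a_one, hδ]
  rw [Metric.eventually_nhds_iff] at ev
  obtain ⟨η, hη, ev⟩ := ev
  obtain ⟨q₀, hq₀, hq₀1⟩ := exists_between (sub_lt_self 1 hη)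
  have hball : ∀ q ∈ Icc q₀ 1, dist q 1 < η := fun q hq => by
    rw [Real.dist_eq, abs_lt]; constructor <;> linarith [hq.1, hq.2]
  have hneg : ∀ q ∈ Icc q₀ 1, q < 1 → ε q < 0 := fun q hq hlt => by
    obtain ⟨⟨e1, e2, e3, e4, -⟩, -, e5, e6, e7, e8⟩ := ev (hball q hq)
    exact ε_neg e1 hlt e2 e3.le e4 e5.le e6 e7 e8
  refine ⟨-ε q₀, neg_pos.2 (hneg q₀ ⟨le_rfl, hq₀1.le⟩ hq₀1), fun e he he0 => ?_⟩
  have hcont : ContinuousOn ε (Icc q₀ 1) := fun q hq => by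
    obtain ⟨⟨e1, e2, e3, e4, -⟩, -⟩ := ev (hball q hq)
    exact (continuousAt_ε e2 e1 e4).continuousWithinAt
  obtain ⟨q, hq, rfl⟩ := intermediate_value_Icc hq₀1.le hcont
    (show e ∈ Icc (ε q₀) (ε 1) by rw [ε_one]; constructor <;> linarith)
  have hq1 : q < 1 := lt_of_le_of_ne hq.2 fun h => by rw [h, ε_one] at he0; exact he0.false
  obtain ⟨⟨e1, e2, e3, e4, e5, e6, e7⟩, ⟨f1, f2, f3, f4, f5⟩, -⟩ := ev (hball q hq)
  have hc := isTwoArcCycle e1 hq1 e2 e3.le e4 e5 e6 e7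
  exact ⟨_, _, _, _, _, _, hc, hc.subset_ball f1 f2 f3 f4 f5⟩

/-! ### The sliding region -/

theorem switchRate_welander (ε : ℝ) (p : ℝ × ℝ) (k : ℝ) :
    switchRate (welanderField ε) Prod.snd p k =
      -3 / 10 - ε / 2 - k * ε - (1 / 2 + k) * p.2 + 2 / 5 * p.1 := by
  have h : fderiv ℝ (Prod.snd : ℝ × ℝ → ℝ) p = ContinuousLinearMap.snd ℝ ℝ ℝ :=
    (ContinuousLinearMap.snd ℝ ℝ ℝ).fderiv
  rw [switchRate, h]
  simp only [ContinuousLinearMap.coe_snd', welanderField, welander, welanderTS]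
  ring

theorem deriv_switchRate_welander (ε : ℝ) (p : ℝ × ℝ) (k : ℝ) :
    deriv (switchRate (welanderField ε) Prod.snd p) k = -ε - p.2 := by
  have h : switchRate (welanderField ε) Prod.snd p =
      fun k => (-ε - p.2) * k + (-3 / 10 - ε / 2 - p.2 / 2 + 2 / 5 * p.1) := by
    funext k
    rw [switchRate_welander]
    ring
  rw [h]
  simp

theorem slidingRegion_welander (ε : ℝ) : slidingRegion (welanderField ε) Prod.snd =
    uIcc (3 / 4 + 15 / 4 * ε) (3 / 4 + 5 / 4 * ε) ×ˢ {(0 : ℝ)} := by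
  ext ⟨x, y⟩
  simp only [slidingRegion, mem_ofPred_eq, mem_prod, mem_singleton_iff, switchRate_welander]
  constructor
  · rintro ⟨rfl, k, hk, h⟩
    refine ⟨?_, rfl⟩
    rw [mem_uIcc]
    rcases le_total 0 ε with h0 | h0
    · exact Or.inr ⟨by nlinarith [hk.1], by nlinarith [hk.2]⟩
    · exact Or.inl ⟨by nlinarith [hk.2], by nlinarith [hk.1]⟩
  · rintro ⟨h, rfl⟩
    refine ⟨rfl, ?_⟩
    rw [mem_uIcc] at h
    rcases eq_or_ne ε 0 with rfl | h0
    · exact ⟨0, by norm_num, by rcases h with h | h <;> linarith [h.1, h.2]⟩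
    -- On y = 0 one has ẏ = (2/5)(x - 3/4 - 5ε/4) - kε; this is its root in k.
    refine ⟨(x - 3 / 4 - 5 / 4 * ε) / (5 / 2 * ε), ?_, by field_simp; ring⟩
    rcases lt_or_gt_of_ne h0 with hn | hp
    · have hn' : 5 / 2 * ε < 0 := by linarith
      constructor
      · rw [le_div_iff_of_neg hn']; rcases h with h | h <;> linarith [h.1, h.2]
      · rw [div_le_iff_of_neg hn']; rcases h with h | h <;> linarith [h.1, h.2]
    · have hp' : 0 < 5 / 2 * ε := by linarith
      constructor
      · rw [le_div_iff₀ hp']; rcases h with h | h <;> linarith [h.1, h.2]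
      · rw [div_le_iff₀ hp']; rcases h with h | h <;> linarith [h.1, h.2]

/-! ### The fused focus -/

theorem eventually_eq_exp_of_hasDerivAt {f : ℝ → ℝ} {c : ℝ}
    (h : ∀ᶠ t in 𝓝 (0 : ℝ), HasDerivAt f (-c * f t) t) :
    ∀ᶠ t in 𝓝 (0 : ℝ), f t = f 0 * Real.exp (-c * t) := by
  rw [Metric.eventually_nhds_iff_ball] at h
  obtain ⟨η, hη, h⟩ := h
  have hd : ∀ t ∈ Metric.ball (0 : ℝ) η, HasDerivAt (fun t => f t * Real.exp (c * t)) 0 t := by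
    intro t ht
    have h2 : HasDerivAt (fun t => Real.exp (c * t)) (Real.exp (c * t) * c) t := by
      simpa using ((hasDerivAt_id t).const_mul c).exp
    refine ((h t ht).fun_mul h2).congr_deriv ?_
    ring
  filter_upwards [Metric.ball_mem_nhds 0 hη] with t ht
  have hconst := Metric.isOpen_ball.is_const_of_deriv_eq_zero (convex_ball (0 : ℝ) η).isPreconnected
    (fun s hs => (hd s hs).differentiableAt.differentiableWithinAt) (fun s hs => (hd s hs).deriv) ht
    (Metric.mem_ball_self hη)
  simp only [mul_zero, Real.exp_zero, mul_one] at hconst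
  rw [← hconst, mul_assoc, ← Real.exp_add]
  simp

theorem hasDerivAt_components {γ : ℝ → ℝ × ℝ} {k t : ℝ}
    (h : HasDerivAt γ (welanderField 0 (γ t) k) t) :
    HasDerivAt (fun t => (γ t).1) (1 - (γ t).1 - k * (γ t).1) t ∧
    HasDerivAt (fun t => (γ t).2 + 4 / 5 * (γ t).1)
      (1 / 2 * (1 - ((γ t).2 + 4 / 5 * (γ t).1)) - k * ((γ t).2 + 4 / 5 * (γ t).1)) t := by
  have h1 := (ContinuousLinearMap.fst ℝ ℝ ℝ).hasFDerivAt.comp_hasDerivAt t h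
  have h2 := (ContinuousLinearMap.snd ℝ ℝ ℝ).hasFDerivAt.comp_hasDerivAt t h
  refine ⟨h1, (h2.add (h1.const_mul (4 / 5))).congr_deriv ?_⟩
  simp only [ContinuousLinearMap.coe_snd', ContinuousLinearMap.coe_fst', welanderField, welander,
    welanderTS]
  ring

theorem exp_ne_one_of_ne_zero {t : ℝ} (ht : t ≠ 0) : Real.exp (-(1 / 2) * t) ≠ 1 := by
  rw [Ne, Real.exp_eq_one_iff]
  simpa using ht

/-- In terms of θ = exp(-t/2), the heights along the trajectories through the point are -(θ -
1)²(3θ² + 2θ + 1)/15 for k = 1 and (θ - 1)²/5 for k = 0. -/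
theorem isInvisibleDoubleTangency_welander :
    IsInvisibleDoubleTangency (welanderField 0) Prod.snd (3 / 4, 0) where
  mem_manifold := rfl
  tangent_pos := by rw [switchRate_welander]; norm_num
  tangent_neg := by rw [switchRate_welander]; norm_num
  invisible_pos := by
    intro γ h0 hγ
    have h1 := eventually_eq_exp_of_hasDerivAt (f := fun t => (γ t).1 - 1 / 2) (c := 2) (by
      filter_upwards [hγ] with t ht
      refine ((hasDerivAt_components ht).1.sub_const _).congr_deriv ?_
      ring)
    have h2 := eventually_eq_exp_of_hasDerivAt
      (f := fun t => (γ t).2 + 4 / 5 * (γ t).1 - 1 / 3) (c := 3 / 2) (by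
      filter_upwards [hγ] with t ht
      refine ((hasDerivAt_components ht).2.sub_const _).congr_deriv ?_
      ring)
    filter_upwards [nhdsWithin_le_nhds h1, nhdsWithin_le_nhds h2, self_mem_nhdsWithin]
      with t e1 e2 ht
    have hθ := exp_ne_one_of_ne_zero ht
    have hθ0 : 0 < Real.exp (-(1 / 2) * t) := Real.exp_pos _
    have x1 : Real.exp (-2 * t) = Real.exp (-(1 / 2) * t) ^ 4 := by
      rw [← Real.exp_nat_mul]; congr 1; push_cast; ring
    have x2 : Real.exp (-(3 / 2) * t) = Real.exp (-(1 / 2) * t) ^ 3 := by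
      rw [← Real.exp_nat_mul]; congr 1; push_cast; ring
    rw [h0, x1] at e1
    rw [h0, x2] at e2
    generalize Real.exp (-(1 / 2) * t) = θ at *
    have hy : (γ t).2 = -((θ - 1) ^ 2 * (3 * θ ^ 2 + 2 * θ + 1) / 15) := by
      linear_combination e2 - 4 / 5 * e1
    have : 0 < (θ - 1) ^ 2 := by
      have := sub_ne_zero.2 hθ
      positivity
    rw [hy, neg_lt_zero]
    positivity
  invisible_neg := by
    intro γ h0 hγ
    have h1 := eventually_eq_exp_of_hasDerivAt (f := fun t => 1 - (γ t).1) (c := 1) (by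
      filter_upwards [hγ] with t ht
      refine ((hasDerivAt_components ht).1.const_sub _).congr_deriv ?_
      ring)
    have h2 := eventually_eq_exp_of_hasDerivAt
      (f := fun t => 1 - ((γ t).2 + 4 / 5 * (γ t).1)) (c := 1 / 2) (by
      filter_upwards [hγ] with t ht
      refine ((hasDerivAt_components ht).2.const_sub _).congr_deriv ?_
      ring)
    filter_upwards [nhdsWithin_le_nhds h1, nhdsWithin_le_nhds h2, self_mem_nhdsWithin]
      with t e1 e2 ht
    have hθ := exp_ne_one_of_ne_zero ht
    have x1 : Real.exp (-1 * t) = Real.exp (-(1 / 2) * t) ^ 2 := by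
      rw [← Real.exp_nat_mul]; congr 1; push_cast; ring
    rw [h0, x1] at e1
    rw [h0] at e2
    generalize Real.exp (-(1 / 2) * t) = θ at *
    have hy : (γ t).2 = (θ - 1) ^ 2 / 5 := by
      linear_combination -e2 + 4 / 5 * e1
    have : 0 < (θ - 1) ^ 2 := by
      have := sub_ne_zero.2 hθ
      positivity
    rw [hy]
    positivity

/-- A Lyapunov function for the fused focus. -/
noncomputable def focusLyapunov (p : ℝ × ℝ) : ℝ :=
  -- The coefficient of y is 5/2 above the line and -5/4 below it: exactly the values that cancel
  -- the term linear in x - 3/4 in the derivative, leaving -4u² - 15y/4 and -2u² + 5y/8.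
  (p.1 - 3 / 4) * (p.1 - 3 / 4) + (5 / 8 * p.2 + 15 / 8 * |p.2|)

theorem continuous_focusLyapunov : Continuous focusLyapunov := by
  unfold focusLyapunov; fun_prop

theorem sq_fst_le_focusLyapunov (p : ℝ × ℝ) : (p.1 - 3 / 4) ^ 2 ≤ focusLyapunov p := by
  unfold focusLyapunov
  nlinarith [neg_abs_le p.2, abs_nonneg p.2]

theorem abs_snd_le_focusLyapunov (p : ℝ × ℝ) : |p.2| ≤ focusLyapunov p := by
  unfold focusLyapunov
  nlinarith [neg_abs_le p.2, abs_nonneg p.2, mul_self_nonneg (p.1 - 3 / 4)]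

theorem dist_lt_of_focusLyapunov_lt {p : ℝ × ℝ} {η : ℝ} (hη : 0 < η)
    (h : focusLyapunov p < min (η ^ 2) η) : dist p (3 / 4, 0) < η := by
  rw [Prod.dist_eq, max_lt_iff, Real.dist_eq, Real.dist_eq, sub_zero]
  exact ⟨abs_lt_of_sq_lt_sq ((sq_fst_le_focusLyapunov p).trans_lt (h.trans_le (min_le_left _ _)))
    hη.le, (abs_snd_le_focusLyapunov p).trans_lt (h.trans_le (min_le_right _ _))⟩

theorem focusLyapunov_pos {p : ℝ × ℝ} (hp : p ≠ (3 / 4, 0)) : 0 < focusLyapunov p := by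
  by_contra h
  refine hp ?_
  have h1 := sq_fst_le_focusLyapunov p
  have h2 := abs_snd_le_focusLyapunov p
  ext
  · have : p.1 - 3 / 4 = 0 := by nlinarith
    simpa using by linarith
  · exact abs_nonpos_iff.1 (by linarith)

/-- This differentiates the nonsmooth V, a maximum of two smooth branches: wherever V is
differentiable along a solution, its derivative agrees with that of each branch touching it from
below. -/
theorem HasDerivAt.eq_of_touching {f g : ℝ → ℝ} {f' g' t : ℝ} (hf : HasDerivAt f f' t)
    (hg : HasDerivAt g g' t) (hle : ∀ s, g s ≤ f s) (he : g t = f t) : f' = g' := by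
  have hmin : IsLocalMin (fun s => f s - g s) t := Eventually.of_forall fun s => by
    simp only [he, sub_self]
    linarith [hle s]
  have := hmin.hasDerivAt_eq_zero (hf.sub hg)
  linarith

section Focus

variable {γ : ℝ → ℝ × ℝ}

theorem IsFilippovSolution.ac_focusLyapunov
    (hγ : IsFilippovSolution (welanderField 0) Prod.snd (Ici 0) γ) {a b : ℝ} (ha : 0 ≤ a)
    (hb : 0 ≤ b) : AbsolutelyContinuousOnInterval (fun t => focusLyapunov (γ t)) a b := by
  have hc : AbsolutelyContinuousOnInterval (fun _ => (3 / 4 : ℝ)) a b :=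
    ContDiffOn.absolutelyContinuousOnInterval (ContDiff.contDiffOn (by fun_prop))
  have h1 := (hγ.ac_fst ha hb).fun_sub hc
  have h2 := hγ.ac_snd ha hb
  have h3 := (lipschitzWith_one_norm (E := ℝ)).comp_absolutelyContinuousOnInterval h2
  exact (h1.fun_mul h1).fun_add ((h2.const_mul (5 / 8)).fun_add (h3.const_mul (15 / 8)))

theorem IsFilippovSolution.ae_deriv_focusLyapunov
    (hγ : IsFilippovSolution (welanderField 0) Prod.snd (Ici 0) γ) {a b : ℝ} (ha : 0 ≤ a)
    (hab : a ≤ b) : ∀ᵐ t, t ∈ Ioo a b → ∃ v, HasDerivAt (fun t => focusLyapunov (γ t)) v t ∧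
      -4 * focusLyapunov (γ t) ≤ v ∧ v ≤ -(1 / 2) * focusLyapunov (γ t) := by
  filter_upwards [(hγ.ac_focusLyapunov ha (ha.trans hab)).ae_differentiableAt, hγ.ae_hasDerivAt]
    with t hd ht htm
  have hV := (hd (by rw [uIcc_of_le hab]; exact ⟨htm.1.le, htm.2.le⟩)).hasDerivAt
  obtain ⟨k, hk, hx, hy⟩ := ht (ha.trans htm.1.le)
  have hu := hx.sub_const (3 / 4)
  have hup : 0 ≤ (γ t).2 → _ := fun h0 => hV.eq_of_touching
    ((hu.fun_mul hu).fun_add (hy.const_mul (5 / 2)))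
    (fun s => by unfold focusLyapunov; linarith [le_abs_self (γ s).2])
    (by unfold focusLyapunov; rw [abs_of_nonneg h0]; ring)
  have hlo : (γ t).2 ≤ 0 → _ := fun h0 => hV.eq_of_touching
    ((hu.fun_mul hu).fun_add (hy.const_mul (-5 / 4)))
    (fun s => by unfold focusLyapunov; linarith [neg_abs_le (γ s).2])
    (by unfold focusLyapunov; rw [abs_of_nonpos h0]; ring)
  refine ⟨_, hV, ?_⟩
  generalize deriv (fun t => focusLyapunov (γ t)) t = v at *
  unfold focusLyapunov
  rcases lt_trichotomy (γ t).2 0 with h | h | h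
  · have e := hlo h.le
    obtain rfl := hk.2.2 h
    rw [abs_of_neg h]
    constructor <;> nlinarith [mul_self_nonneg ((γ t).1 - 3 / 4)]
  -- On the line both branches touch, so 5ẏ/2 = -5ẏ/4. Hence ẏ = 0, which forces x = 3/4, and
  -- sliding or grazing away from the focus has measure zero.
  · have e1 := hup h.ge
    have e2 := hlo h.le
    rw [h] at e1 e2 ⊢
    have hx0 : (γ t).1 = 3 / 4 := by linarith
    rw [hx0] at e1 ⊢
    simp only [abs_zero]
    constructor <;> nlinarith
  · have e := hup h.le
    obtain rfl := hk.2.1 h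
    rw [abs_of_pos h]
    constructor <;> nlinarith [mul_self_nonneg ((γ t).1 - 3 / 4)]

theorem IsFilippovSolution.focusLyapunov_le
    (hγ : IsFilippovSolution (welanderField 0) Prod.snd (Ici 0) γ) {t : ℝ} (ht : 0 ≤ t) :
    focusLyapunov (γ t) ≤ focusLyapunov (γ 0) * Real.exp (-(1 / 2) * t) := by
  have h := (hγ.ac_focusLyapunov le_rfl ht).le_exp_of_ae_deriv_le (c := 1 / 2) ht (by
    filter_upwards [hγ.ae_deriv_focusLyapunov le_rfl ht] with s hs hsm
    obtain ⟨v, h1, -, h2⟩ := hs hsm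
    exact ⟨v, h1, h2⟩)
  simpa using h

theorem IsFilippovSolution.le_focusLyapunov
    (hγ : IsFilippovSolution (welanderField 0) Prod.snd (Ici 0) γ) {t : ℝ} (ht : 0 ≤ t) :
    focusLyapunov (γ 0) * Real.exp (-4 * t) ≤ focusLyapunov (γ t) := by
  have h := (hγ.ac_focusLyapunov le_rfl ht).exp_le_of_ae_le_deriv (c := 4) ht (by
    filter_upwards [hγ.ae_deriv_focusLyapunov le_rfl ht] with s hs hsm
    obtain ⟨v, h1, h2, -⟩ := hs hsm
    exact ⟨v, h1, h2⟩)
  simpa using h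

theorem IsFilippovSolution.tendsto_focusLyapunov
    (hγ : IsFilippovSolution (welanderField 0) Prod.snd (Ici 0) γ) :
    Tendsto (fun t => focusLyapunov (γ t)) atTop (𝓝 0) := by
  have hlim : Tendsto (fun t : ℝ => focusLyapunov (γ 0) * Real.exp (-(1 / 2) * t)) atTop (𝓝 0) := by
    have h1 : Tendsto (fun t : ℝ => -(1 / 2) * t) atTop atBot :=
      tendsto_id.const_mul_atTop_of_neg (by norm_num)
    simpa using (Real.tendsto_exp_atBot.comp h1).const_mul (focusLyapunov (γ 0))
  refine tendsto_of_tendsto_of_tendsto_of_le_of_le' tendsto_const_nhds hlim ?_ ?_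
  · exact Eventually.of_forall fun t => (abs_nonneg _).trans (abs_snd_le_focusLyapunov _)
  · filter_upwards [eventually_ge_atTop 0] with t ht using hγ.focusLyapunov_le ht

/-- The lower exponential bound on V keeps it positive for all finite times. -/
theorem IsFilippovSolution.ne_focus
    (hγ : IsFilippovSolution (welanderField 0) Prod.snd (Ici 0) γ) (h0 : γ 0 ≠ (3 / 4, 0)) {t : ℝ}
    (ht : 0 ≤ t) : γ t ≠ (3 / 4, 0) := by
  intro h
  have h1 := hγ.le_focusLyapunov ht
  have h2 := mul_pos (focusLyapunov_pos h0) (Real.exp_pos (-4 * t))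
  have h3 : focusLyapunov (γ t) = 0 := by rw [h]; simp [focusLyapunov]
  linarith

/-- A solution that is not at the focus cannot touch `y = 0` without crossing. -/
theorem IsFilippovSolution.ae_snd_ne_zero
    (hγ : IsFilippovSolution (welanderField 0) Prod.snd (Ici 0) γ) (h0 : γ 0 ≠ (3 / 4, 0)) :
    ∀ᵐ t, 0 ≤ t → IsLocalExtr (fun t => (γ t).2) t → (γ t).2 ≠ 0 := by
  filter_upwards [hγ.ae_hasDerivAt] with t ht h0t hext hy0
  obtain ⟨k, -, -, hy⟩ := ht h0t
  have h := hext.hasDerivAt_eq_zero hy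
  rw [hy0] at h
  refine hγ.ne_focus h0 h0t ?_
  ext
  · simp only; linarith
  · exact hy0

/-- If y ≤ 0 from some time on, every zero of y is a local maximum, so k = 0 almost everywhere. Once
|x - 3/4| < 1/8 this gives ẋ ≥ 1/8, and in 4 time units x gains at least 1/2, more than the
available width 1/4. -/
theorem IsFilippovSolution.frequently_pos
    (hγ : IsFilippovSolution (welanderField 0) Prod.snd (Ici 0) γ) (h0 : γ 0 ≠ (3 / 4, 0)) :
    ∃ᶠ t in atTop, 0 < (γ t).2 := by
  intro hev
  have hsm := hγ.tendsto_focusLyapunov.eventually_lt_const (show (0 : ℝ) < (1 / 8) ^ 2 by norm_num)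
  obtain ⟨T, hT⟩ := eventually_atTop.1 ((hev.and hsm).and (eventually_ge_atTop 0))
  have hT0 : 0 ≤ T := (hT T le_rfl).2
  have hu : ∀ t, T ≤ t → |(γ t).1 - 3 / 4| < 1 / 8 := fun t ht =>
    abs_lt_of_sq_lt_sq ((sq_fst_le_focusLyapunov _).trans_lt (hT t ht).1.2) (by norm_num)
  have hy : ∀ t, T ≤ t → (γ t).2 ≤ 0 := fun t ht => not_lt.1 (hT t ht).1.1
  have hle := AbsolutelyContinuousOnInterval.le_of_ae_deriv_nonpos
    (f := fun s => 1 / 8 * s - (γ s).1) (a := T) (b := T + 4) (by linarith)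
    ((ContDiffOn.absolutelyContinuousOnInterval (ContDiff.contDiffOn (by fun_prop))).sub
      (hγ.ac_fst hT0 (by linarith))) (by
      filter_upwards [hγ.ae_hasDerivAt, hγ.ae_snd_ne_zero h0] with s hs hs' hsm
      have hs0 := hT0.trans hsm.1.le
      obtain ⟨k, hk, hx, -⟩ := hs hs0
      have hne : (γ s).2 ≠ 0 := fun he => hs' hs0 (Or.inr (by
        filter_upwards [lt_mem_nhds hsm.1] with t ht
        rw [he]; exact hy t ht.le)) he
      obtain rfl := hk.2.2 (lt_of_le_of_ne (hy s hsm.1.le) hne)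
      have hd := (((hasDerivAt_id s).const_mul (1 / 8 : ℝ)).sub hx).deriv
      have e : deriv (fun s => 1 / 8 * s - (γ s).1) s = _ := hd
      rw [e]
      have := abs_lt.1 (hu s hsm.1.le)
      linarith [this.2])
  beta_reduce at hle
  have h1 := abs_lt.1 (hu T le_rfl)
  have h2 := abs_lt.1 (hu (T + 4) (by linarith))
  linarith [h1.1, h2.2]

theorem IsFilippovSolution.frequently_neg
    (hγ : IsFilippovSolution (welanderField 0) Prod.snd (Ici 0) γ) (h0 : γ 0 ≠ (3 / 4, 0)) :
    ∃ᶠ t in atTop, (γ t).2 < 0 := by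
  intro hev
  have hsm := hγ.tendsto_focusLyapunov.eventually_lt_const (show (0 : ℝ) < (1 / 8) ^ 2 by norm_num)
  obtain ⟨T, hT⟩ := eventually_atTop.1 ((hev.and hsm).and (eventually_ge_atTop 0))
  have hT0 : 0 ≤ T := (hT T le_rfl).2
  have hu : ∀ t, T ≤ t → |(γ t).1 - 3 / 4| < 1 / 8 := fun t ht =>
    abs_lt_of_sq_lt_sq ((sq_fst_le_focusLyapunov _).trans_lt (hT t ht).1.2) (by norm_num)
  have hy : ∀ t, T ≤ t → 0 ≤ (γ t).2 := fun t ht => not_lt.1 (hT t ht).1.1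
  have hle := AbsolutelyContinuousOnInterval.le_of_ae_deriv_nonpos
    (f := fun s => 1 / 8 * s + (γ s).1) (a := T) (b := T + 4) (by linarith)
    ((ContDiffOn.absolutelyContinuousOnInterval (ContDiff.contDiffOn (by fun_prop))).add
      (hγ.ac_fst hT0 (by linarith))) (by
      filter_upwards [hγ.ae_hasDerivAt, hγ.ae_snd_ne_zero h0] with s hs hs' hsm
      have hs0 := hT0.trans hsm.1.le
      obtain ⟨k, hk, hx, -⟩ := hs hs0
      have hne : (γ s).2 ≠ 0 := fun he => hs' hs0 (Or.inl (by
        filter_upwards [lt_mem_nhds hsm.1] with t ht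
        rw [he]; exact hy t ht.le)) he
      obtain rfl := hk.2.1 (lt_of_le_of_ne (hy s hsm.1.le) hne.symm)
      have hd := (((hasDerivAt_id s).const_mul (1 / 8 : ℝ)).add hx).deriv
      have e : deriv (fun s => 1 / 8 * s + (γ s).1) s = _ := hd
      rw [e]
      have := abs_lt.1 (hu s hsm.1.le)
      linarith [this.1])
  beta_reduce at hle
  have h1 := abs_lt.1 (hu T le_rfl)
  have h2 := abs_lt.1 (hu (T + 4) (by linarith))
  linarith [h1.2, h2.1]

end Focus

theorem isAsymptoticallyStable_focus :
    IsAsymptoticallyStable (welanderField 0) Prod.snd {((3 / 4 : ℝ), (0 : ℝ))} := by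
  simp only [IsAsymptoticallyStable, Metric.infDist_singleton]
  constructor
  · intro η hη
    have hm : 0 < min (η ^ 2) η := lt_min (by positivity) hη
    have hc : ∀ᶠ p in 𝓝 ((3 / 4 : ℝ), (0 : ℝ)), focusLyapunov p < min (η ^ 2) η :=
      continuous_focusLyapunov.continuousAt.eventually_lt continuousAt_const
        (by simpa [focusLyapunov] using hm)
    rw [Metric.eventually_nhds_iff] at hc
    obtain ⟨δ, hδ, hc⟩ := hc
    refine ⟨δ, hδ, fun γ hγ h0 t ht => dist_lt_of_focusLyapunov_lt hη
      ((hγ.focusLyapunov_le ht).trans_lt ((mul_le_of_le_one_right ?_ ?_).trans_lt (hc h0)))⟩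
    · exact (abs_nonneg _).trans (abs_snd_le_focusLyapunov _)
    · exact Real.exp_le_one_iff.2 (by linarith)
  · refine ⟨1, one_pos, fun γ hγ _ => ?_⟩
    rw [Metric.tendsto_nhds]
    intro η hη
    filter_upwards [hγ.tendsto_focusLyapunov.eventually_lt_const
      (show 0 < min (η ^ 2) η from lt_min (by positivity) hη)] with t ht
    rw [Real.dist_eq, sub_zero, abs_of_nonneg dist_nonneg]
    exact dist_lt_of_focusLyapunov_lt hη ht

theorem isStableFusedFocus_welander :
    IsStableFusedFocus (welanderField 0) Prod.snd (3 / 4, 0) where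
  doubleTangency := isInvisibleDoubleTangency_welander
  focus := ⟨1, one_pos, fun _ hγ h0 _ => ⟨hγ.frequently_pos h0, hγ.frequently_neg h0⟩⟩
  stable := isAsymptoticallyStable_focus

/-! ### The main theorem. -/

theorem mainTheorem3 :
    -- the sliding region, and the tangencies of the two fields, which bound it
    (∀ ε : ℝ, slidingRegion (welander (4 / 5) (1 / 2) ε) Prod.snd =
      uIcc (3 / 4 + 15 / 4 * ε) (3 / 4 + 5 / 4 * ε) ×ˢ {(0 : ℝ)}) ∧
    (∀ ε x : ℝ, switchRate (welander (4 / 5) (1 / 2) ε) Prod.snd (x, 0) 1 = 0 ↔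
      x = 3 / 4 + 15 / 4 * ε) ∧
    (∀ ε x : ℝ, switchRate (welander (4 / 5) (1 / 2) ε) Prod.snd (x, 0) 0 = 0 ↔
      x = 3 / 4 + 5 / 4 * ε) ∧
    -- its stability
    (∀ ε : ℝ, 0 < ε → IsStableSliding (welander (4 / 5) (1 / 2) ε) Prod.snd) ∧
    (∀ ε : ℝ, ε < 0 → IsUnstableSliding (welander (4 / 5) (1 / 2) ε) Prod.snd) ∧
    -- collapse to a stable fused focus
    slidingRegion (welander (4 / 5) (1 / 2) 0) Prod.snd = {((3 / 4 : ℝ), (0 : ℝ))} ∧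
    IsStableFusedFocus (welander (4 / 5) (1 / 2) 0) Prod.snd (3 / 4, 0) ∧
    -- small stable periodic orbits for small negative `ε`
    (∀ δ > 0, ∃ ε₀ > 0, ∀ ε : ℝ, -ε₀ < ε → ε < 0 →
      ∃ Γ ⊆ Metric.ball ((3 / 4 : ℝ), (0 : ℝ)) δ,
        IsPeriodicOrbit (welander (4 / 5) (1 / 2) ε) Prod.snd Γ ∧
        IsAsymptoticallyStable (welander (4 / 5) (1 / 2) ε) Prod.snd Γ) := by
  refine ⟨slidingRegion_welander, fun ε x => ?_, fun ε x => ?_, fun ε hε p hp k _ _ => ?_,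
    fun ε hε p hp k _ _ => ?_, ?_, isStableFusedFocus_welander, fun δ hδ => ?_⟩
  · rw [switchRate_welander]
    constructor <;> intro h <;> linarith
  · rw [switchRate_welander]
    constructor <;> intro h <;> linarith
  · rw [deriv_switchRate_welander, hp.1]
    linarith
  · rw [deriv_switchRate_welander, hp.1]
    linarith
  · rw [slidingRegion_welander]
    simp
  · obtain ⟨ε₀, hε₀, h⟩ := exists_isTwoArcCycle hδ
    refine ⟨ε₀, hε₀, fun ε h1 h2 => ?_⟩
    obtain ⟨ξ, σ, X, Y, q, r, hc, hball⟩ := h ε h1 h2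
    exact ⟨_, hball, hc.isPeriodicOrbit, hc.isAsymptoticallyStable⟩
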